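/- Let $\tilde{\mathcal A}=\{\sum_{\nu\ge 0}P_\nu(a)\,b^\nu : P_\nu\in\mathbb C[z]\}$ be the $\mathbb C$-algebra with $ab-ba=b^2$ and $b$-adically continuous multiplication. Monomials in $a$ and $b$ are graded by total degree ("degree in $(a,b)$"): the homogeneous elements of degree $n$ are the linear combinations of $a^jb^{n-j}$, $0\le j\le n$ (only $0$ if $n<0$), and the $(a,b)$-valuation of an element is the least degree of a non-zero homogeneous part. An $(a,b)$-module is a left $\tilde{\mathcal A}$-module that is free of finite rank over $\mathbb C[[b]]$; it is regular if it embeds in an $(a,b)$-module $F$ with $aF\subset bF$, and monogenic if it is isomorphic to $\tilde{\mathcal A}/I$ for a left ideal $I$. Let $E$ be a monogenic regular $(a,b)$-module of rank $k$. There is a unique element $P_E\in\tilde{\mathcal A}$ (the Bernstein element of $E$), homogeneous of degree $k$ in $(a,b)$ and monic in $a$, such that $E\simeq\tilde{\mathcal A}/\tilde{\mathcal A}(P_E+b^2R)$ for some polynomial $R$ in $a$ of degree $\le k-1$ with coefficients in $\mathbb C[[b]]$ and of $(a,b)$-valuation $\ge k-1$. Moreover: 1. $E$ is isomorphic to a quotient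 $\tilde{\mathcal A}/\tilde{\mathcal A}x$ with $x=P_E+b^3S$, where $S$ is a polynomial in $a$ of degree $\le k-1$ with coefficients in $\mathbb C[[b]]$ and of $(a,b)$-valuation $\ge k-2$. 2. There is $\beta_0\in\mathbb C$ such that $[P_E,a+\beta_0 b]$ has degree $\le k-2$ in $a$. If $x=P_E+b^3S$ and $x'=P_E+b^3S'$ are two elements as in 1, and $S_{k-2}$, $S'_{k-2}$ are the homogeneous parts of degree $k-2$ in $(a,b)$ of $S$ and $S'$, then for all $(\alpha,\beta)\in\mathbb C^2\setminus\{(0,0)\}$ such that $[P_E,\alpha a+\beta b]$ has degree $\le k-2$ in $a$, $$b^3S_{k-2}-b^3S'_{k-2}\in\mathbb C\cdot[P_E,\alpha a+\beta b].$$ (A negative bound on the degree in $a$ means that the element is $0$.) Thus $S_{k-2}$ depends only on the isomorphism class of $E$, modulo this line of commutators. -/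

import Mathlib

noncomputable section

/-- The underlying additive group of the algebra `Ã`: a family `ν ↦ P_ν` of polynomials stands for
the series `∑ b^ν P_ν(a)`; the power series variable is `b`, the polynomial variable is `a`.
(Since `a b = b (a + b)`, these are the same series as the `∑ P_ν(a) b^ν`.) -/
def ABAlgebra : Type := PowerSeries (Polynomial ℂ)

namespace ABAlgebra

instance : AddCommGroup ABAlgebra := inferInstanceAs (AddCommGroup (PowerSeries (Polynomial ℂ)))

instance : Module ℂ ABAlgebra := inferInstanceAs (Module ℂ (PowerSeries (Polynomial ℂ)))

/-- `∂/∂a` on commutative series `∑ b^ν P_ν(a)`. -/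
def dA : Module.End ℂ (PowerSeries (Polynomial ℂ)) where
  toFun f := PowerSeries.mk fun n => Polynomial.derivative (PowerSeries.coeff n f)
  map_add' f g := by ext1 n; simp
  map_smul' c f := by ext1 n; simp

/-- `b² ∂/∂b` on commutative series `∑ b^ν P_ν(a)`. -/
def dB : Module.End ℂ (PowerSeries (Polynomial ℂ)) where
  toFun f := PowerSeries.X ^ 2 * PowerSeries.derivative (Polynomial ℂ) f
  map_add' f g := by simp [mul_add]
  map_smul' c f := by
    have h : PowerSeries.derivative (Polynomial ℂ) (c • f)
        = c • PowerSeries.derivative (Polynomial ℂ) f := by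
      ext1 n; simp [PowerSeries.coeff_derivative]
    simp [h]

theorem dA_mul (f g : PowerSeries (Polynomial ℂ)) : dA (f * g) = dA f * g + f * dA g := by
  ext1 n
  simp [dA, PowerSeries.coeff_mul, Finset.sum_add_distrib]

theorem dB_mul (f g : PowerSeries (Polynomial ℂ)) : dB (f * g) = dB f * g + f * dB g := by
  simp [dB]; ring

theorem dA_dB (f : PowerSeries (Polynomial ℂ)) : dA (dB f) = dB (dA f) := by
  ext1 n
  rcases n with _ | _ | n
  · simp [dA, dB, PowerSeries.coeff_X_pow_mul']
  · simp [dA, dB, PowerSeries.coeff_X_pow_mul']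
  · simp [dA, dB, PowerSeries.coeff_X_pow_mul', PowerSeries.coeff_derivative]

theorem dA_dB_pow (i j : ℕ) (f : PowerSeries (Polynomial ℂ)) :
    (dA ^ i) ((dB ^ j) f) = (dB ^ j) ((dA ^ i) f) := by
  have h : Commute dA dB := LinearMap.ext fun f => dA_dB f
  exact LinearMap.congr_fun (h.pow_pow i j) f

theorem dvd_smul_of (c : ℂ) {p f : PowerSeries (Polynomial ℂ)} (h : p ∣ f) : p ∣ c • f := by
  obtain ⟨g, rfl⟩ := h
  exact ⟨c • g, (mul_smul_comm c p g).symm⟩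

theorem X_pow_dvd_dB_pow (j : ℕ) (f : PowerSeries (Polynomial ℂ)) :
    PowerSeries.X ^ j ∣ (dB ^ j) f := by
  induction j with
  | zero => simp
  | succ j ih =>
    obtain ⟨g, hg⟩ := ih
    rw [pow_succ' dB, Module.End.mul_apply, hg]
    have : dB (PowerSeries.X ^ j * g) = PowerSeries.X ^ (j + 1) *
        ((j : PowerSeries (Polynomial ℂ)) * g
          + PowerSeries.X * PowerSeries.derivative (Polynomial ℂ) g) := by
      rcases j with _ | j
      · simp [dB]; ring
      · simp [dB]; ring
    rw [this]
    exact dvd_mul_right _ _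

/-- Leibniz' formula for divided powers of a derivation. -/
theorem leibniz_divided (D : Module.End ℂ (PowerSeries (Polynomial ℂ)))
    (hD : ∀ f g, D (f * g) = D f * g + f * D g) (n : ℕ) (f g : PowerSeries (Polynomial ℂ)) :
    ((n.factorial : ℂ)⁻¹) • (D ^ n) (f * g) = ∑ p ∈ Finset.HasAntidiagonal.antidiagonal n,
      ((p.1.factorial : ℂ)⁻¹ * (p.2.factorial : ℂ)⁻¹) • ((D ^ p.1) f * (D ^ p.2) g) := by
  have key : (D ^ n) (f * g) = ∑ p ∈ Finset.HasAntidiagonal.antidiagonal n,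
      (n.choose p.1) • ((D ^ p.1) f * (D ^ p.2) g) := by
    induction n with
    | zero => simp
    | succ n ih =>
      rw [Finset.sum_antidiagonal_choose_succ_nsmul
        (fun i j => (D ^ i) f * (D ^ j) g) n, pow_succ', Module.End.mul_apply, ih, map_sum,
        ← Finset.sum_add_distrib]
      refine Finset.sum_congr rfl fun p hp => ?_
      have hs : n.choose p.2 = n.choose p.1 :=
        Nat.choose_symm_of_eq_add (by rw [← Finset.HasAntidiagonal.mem_antidiagonal.1 hp, add_comm])
      rw [map_nsmul, hD, pow_succ', pow_succ', Module.End.mul_apply, Module.End.mul_apply,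
        smul_add, add_comm, hs]
  rw [key, Finset.smul_sum]
  refine Finset.sum_congr rfl fun p hp => ?_
  have hp' := Finset.HasAntidiagonal.mem_antidiagonal.1 hp
  rw [← Nat.cast_smul_eq_nsmul ℂ, smul_smul]
  congr 1
  have h1 : (n.choose p.1 * p.1.factorial * p.2.factorial : ℂ) = n.factorial := by
    have := Nat.add_choose_mul_factorial_mul_factorial p.1 p.2
    rw [hp'] at this
    rw [Nat.choose_symm_of_eq_add (show n = p.2 + p.1 by omega)] at this
    exact_mod_cast this
  have hn : (n.factorial : ℂ) ≠ 0 := by exact_mod_cast n.factorial_ne_zero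
  have h2 : (p.1.factorial : ℂ) ≠ 0 := by exact_mod_cast p.1.factorial_ne_zero
  have h3 : (p.2.factorial : ℂ) ≠ 0 := by exact_mod_cast p.2.factorial_ne_zero
  field_simp
  linear_combination h1

/-- The partial sum over `j < L` of the product. -/
def mulTo (L : ℕ) (f g : PowerSeries (Polynomial ℂ)) : PowerSeries (Polynomial ℂ) :=
  ∑ j ∈ Finset.range L, ((j.factorial : ℂ)⁻¹) • ((dA ^ j) f * (dB ^ j) g)

theorem coeff_eq_zero_of_dvd {N L : ℕ} (h : N < L) {f : PowerSeries (Polynomial ℂ)}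
    (hf : PowerSeries.X ^ L ∣ f) : PowerSeries.coeff N f = 0 :=
  PowerSeries.X_pow_dvd_iff.1 hf N h

theorem coeff_mulTo {N L : ℕ} (h : N < L) (f g : PowerSeries (Polynomial ℂ)) :
    PowerSeries.coeff N (mulTo L f g) = PowerSeries.coeff N (mulTo (N + 1) f g) := by
  have hsub : Finset.range (N + 1) ⊆ Finset.range L := Finset.range_subset_range.2 h
  rw [mulTo, mulTo, map_sum, map_sum]
  symm
  refine Finset.sum_subset hsub fun j _ hj => ?_
  have hj' : N < j := by simpa using hj
  exact coeff_eq_zero_of_dvd hj' (dvd_smul_of _ ((X_pow_dvd_dB_pow j g).mul_left _))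

/-- The product of `Ã`, transported to commutative series: it is the formal sum
`∑_j (1/j!) (∂/∂a)^j f · (b² ∂/∂b)^j g`, which converges `b`-adically because the `j`-th term is
divisible by `b^j`. It is the only `b`-adically continuous bilinear associative product with
`a b - b a = b²` for which the series `∑ b^ν P_ν(a)` denote themselves. -/
def star (f g : PowerSeries (Polynomial ℂ)) : PowerSeries (Polynomial ℂ) :=
  PowerSeries.mk fun N => PowerSeries.coeff N
    (∑ j ∈ Finset.range (N + 1), ((j.factorial : ℂ)⁻¹) • ((dA ^ j) f * (dB ^ j) g))

theorem coeff_star {N L : ℕ} (h : N < L) (f g : PowerSeries (Polynomial ℂ)) :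
    PowerSeries.coeff N (star f g) = PowerSeries.coeff N (mulTo L f g) := by
  rw [coeff_mulTo h, star, PowerSeries.coeff_mk, mulTo]

theorem star_sub_mulTo_dvd (L : ℕ) (f g : PowerSeries (Polynomial ℂ)) :
    PowerSeries.X ^ L ∣ star f g - mulTo L f g := by
  rw [PowerSeries.X_pow_dvd_iff]
  intro m hm
  rw [map_sub, coeff_star hm, sub_self]

theorem dA_pow_dvd (L j : ℕ) {f : PowerSeries (Polynomial ℂ)} (h : PowerSeries.X ^ L ∣ f) :
    PowerSeries.X ^ L ∣ (dA ^ j) f := by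
  induction j with
  | zero => simpa using h
  | succ j ih =>
    rw [pow_succ', Module.End.mul_apply, PowerSeries.X_pow_dvd_iff]
    intro m hm
    have h0 := coeff_eq_zero_of_dvd hm ih
    simp only [dA, LinearMap.coe_mk, AddHom.coe_mk, PowerSeries.coeff_mk] at h0 ⊢
    rw [h0, map_zero]

theorem dB_pow_dvd (L j : ℕ) {f : PowerSeries (Polynomial ℂ)} (h : PowerSeries.X ^ L ∣ f) :
    PowerSeries.X ^ L ∣ (dB ^ j) f := by
  induction j with
  | zero => simpa using h
  | succ j ih =>
    rw [pow_succ', Module.End.mul_apply]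
    obtain ⟨g, hg⟩ := ih
    have h1 : PowerSeries.X ^ L ∣ dB (PowerSeries.X ^ L : PowerSeries (Polynomial ℂ)) := by
      rcases L with _ | L
      · simp
      · refine ⟨((L : PowerSeries (Polynomial ℂ)) + 1) * PowerSeries.X, ?_⟩
        simp [dB]; ring
    rw [hg, dB_mul]
    exact dvd_add (h1.mul_right _) (dvd_mul_right _ _)

theorem mulTo_sub_left (L : ℕ) (f f' g : PowerSeries (Polynomial ℂ)) :
    mulTo L f g - mulTo L f' g = mulTo L (f - f') g := by
  simp only [mulTo, map_sub, sub_mul, smul_sub, Finset.sum_sub_distrib]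

theorem mulTo_sub_right (L : ℕ) (f g g' : PowerSeries (Polynomial ℂ)) :
    mulTo L f g - mulTo L f g' = mulTo L f (g - g') := by
  simp only [mulTo, map_sub, mul_sub, smul_sub, Finset.sum_sub_distrib]

theorem coeff_star_star_left (N : ℕ) (f g h : PowerSeries (Polynomial ℂ)) :
    PowerSeries.coeff N (star (star f g) h)
      = PowerSeries.coeff N (mulTo (N + 1) (mulTo (N + 1) f g) h) := by
  rw [coeff_star (Nat.lt_succ_self N), ← sub_eq_zero, ← map_sub, mulTo_sub_left]
  refine coeff_eq_zero_of_dvd (Nat.lt_succ_self N) (Finset.dvd_sum fun j _ => ?_)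
  exact dvd_smul_of _ ((dA_pow_dvd _ j (star_sub_mulTo_dvd _ f g)).mul_right _)

theorem coeff_star_star_right (N : ℕ) (f g h : PowerSeries (Polynomial ℂ)) :
    PowerSeries.coeff N (star f (star g h))
      = PowerSeries.coeff N (mulTo (N + 1) f (mulTo (N + 1) g h)) := by
  rw [coeff_star (Nat.lt_succ_self N), ← sub_eq_zero, ← map_sub, mulTo_sub_right]
  refine coeff_eq_zero_of_dvd (Nat.lt_succ_self N) (Finset.dvd_sum fun j _ => ?_)
  exact dvd_smul_of _ ((dB_pow_dvd _ j (star_sub_mulTo_dvd _ g h)).mul_left _)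

theorem sum_triangle {M : Type*} [AddCommMonoid M] (L : ℕ) (G : ℕ → ℕ → M)
    (hG : ∀ i j, L ≤ i + j → G i j = 0) :
    ∑ i ∈ Finset.range L, ∑ p ∈ Finset.HasAntidiagonal.antidiagonal i, G p.1 p.2
      = ∑ i ∈ Finset.range L, ∑ j ∈ Finset.range L, G i j := by
  rw [Finset.sum_sigma', ← Finset.sum_product']
  refine Finset.sum_bij_ne_zero (fun x _ _ => x.2) ?_ ?_ ?_ ?_
  · rintro ⟨i, p⟩ hx _
    simp only [Finset.mem_sigma, Finset.mem_range, Finset.HasAntidiagonal.mem_antidiagonal] at hx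
    simp only [Finset.mem_product, Finset.mem_range]
    omega
  · rintro ⟨i, p⟩ hx _ ⟨i', p'⟩ hx' _ h
    simp only [Finset.mem_sigma, Finset.mem_range, Finset.HasAntidiagonal.mem_antidiagonal] at hx hx'
    obtain rfl : p = p' := h
    obtain rfl : i = i' := by omega
    rfl
  · rintro ⟨i, j⟩ hx hne
    simp only [Finset.mem_product, Finset.mem_range] at hx
    have hlt : i + j < L := by
      by_contra hc
      exact hne (hG i j (by omega))
    exact ⟨⟨i + j, (i, j)⟩, by simp [hlt], hne, rfl⟩
  · intros; rfl

theorem star_assoc (f g h : PowerSeries (Polynomial ℂ)) :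
    star (star f g) h = star f (star g h) := by
  ext1 N
  rw [coeff_star_star_left, coeff_star_star_right]
  set L := N + 1 with hL
  let w : ℕ → ℕ → ℕ → ℂ := fun i j l =>
    (i.factorial : ℂ)⁻¹ * (j.factorial : ℂ)⁻¹ * (l.factorial : ℂ)⁻¹
  let F : ℕ → ℕ → ℕ → Polynomial ℂ := fun i j l => PowerSeries.coeff N
    (w i j l • ((dA ^ (i + j)) f * (dB ^ i) ((dA ^ l) g) * (dB ^ (j + l)) h))
  have hF : ∀ i j l, (L ≤ i + j ∨ L ≤ j + l) → F i j l = 0 := by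
    intro i j l hij
    have h1 : PowerSeries.X ^ (i + (j + l)) ∣
        (dA ^ (i + j)) f * (dB ^ i) ((dA ^ l) g) * (dB ^ (j + l)) h := by
      rw [pow_add]
      exact mul_dvd_mul ((X_pow_dvd_dB_pow i _).mul_left _) (X_pow_dvd_dB_pow _ _)
    exact coeff_eq_zero_of_dvd (show N < i + (j + l) by omega) (dvd_smul_of _ h1)
  have hleft : PowerSeries.coeff N (mulTo L (mulTo L f g) h)
      = ∑ i ∈ Finset.range L, ∑ j ∈ Finset.range L, ∑ l ∈ Finset.range L, F i j l := by
    have : ∀ i ∈ Finset.range L, ∑ j ∈ Finset.range L, ∑ l ∈ Finset.range L, F i j l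
        = ∑ m ∈ Finset.range L, ∑ p ∈ Finset.HasAntidiagonal.antidiagonal m, F i p.1 p.2 := fun i _ =>
      (sum_triangle L (F i) fun j l hjl => hF i j l (Or.inr hjl)).symm
    rw [Finset.sum_congr rfl this, Finset.sum_comm, mulTo, map_sum]
    refine Finset.sum_congr rfl fun m _ => ?_
    have h2 : ((m.factorial : ℂ)⁻¹) • ((dA ^ m) (mulTo L f g) * (dB ^ m) h)
        = ∑ i ∈ Finset.range L, ∑ p ∈ Finset.HasAntidiagonal.antidiagonal m,
          w i p.1 p.2 • ((dA ^ (i + p.1)) f * (dB ^ i) ((dA ^ p.2) g) * (dB ^ (p.1 + p.2)) h) := by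
      rw [← smul_mul_assoc, mulTo, map_sum, Finset.smul_sum, Finset.sum_mul]
      refine Finset.sum_congr rfl fun i _ => ?_
      rw [map_smul, smul_comm, leibniz_divided dA dA_mul, Finset.smul_sum, Finset.sum_mul]
      refine Finset.sum_congr rfl fun p hp => ?_
      rw [Finset.HasAntidiagonal.mem_antidiagonal.1 hp, smul_smul, smul_mul_assoc, ← Module.End.mul_apply,
        ← pow_add, dA_dB_pow, add_comm i p.1, ← mul_assoc]
    rw [h2, map_sum]
    refine Finset.sum_congr rfl fun i _ => ?_
    rw [map_sum]
  have hright : PowerSeries.coeff N (mulTo L f (mulTo L g h))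
      = ∑ i ∈ Finset.range L, ∑ j ∈ Finset.range L, ∑ l ∈ Finset.range L, F i j l := by
    have h3 : ∑ i ∈ Finset.range L, ∑ j ∈ Finset.range L, ∑ l ∈ Finset.range L, F i j l
        = ∑ m ∈ Finset.range L, ∑ p ∈ Finset.HasAntidiagonal.antidiagonal m,
          ∑ l ∈ Finset.range L, F p.1 p.2 l :=
      (sum_triangle L (fun i j => ∑ l ∈ Finset.range L, F i j l) fun i j hij =>
        Finset.sum_eq_zero fun l _ => hF i j l (Or.inl hij)).symm
    rw [h3, mulTo, map_sum]
    refine Finset.sum_congr rfl fun m _ => ?_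
    rw [Finset.sum_comm]
    have h2 : ((m.factorial : ℂ)⁻¹) • ((dA ^ m) f * (dB ^ m) (mulTo L g h))
        = ∑ l ∈ Finset.range L, ∑ p ∈ Finset.HasAntidiagonal.antidiagonal m,
          w p.1 p.2 l • ((dA ^ (p.1 + p.2)) f * (dB ^ p.1) ((dA ^ l) g) * (dB ^ (p.2 + l)) h) := by
      rw [← mul_smul_comm, mulTo, map_sum, Finset.smul_sum, Finset.mul_sum]
      refine Finset.sum_congr rfl fun l _ => ?_
      rw [map_smul, smul_comm, leibniz_divided dB dB_mul, Finset.smul_sum, Finset.mul_sum]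
      refine Finset.sum_congr rfl fun p hp => ?_
      rw [Finset.HasAntidiagonal.mem_antidiagonal.1 hp, smul_smul, mul_smul_comm, pow_add dB, Module.End.mul_apply,
        ← mul_assoc]
      congr 1
      · simp only [w]; ring
      · rw [mul_assoc]
    rw [h2, map_sum]
    refine Finset.sum_congr rfl fun i _ => ?_
    rw [map_sum]
  rw [hleft, hright]

theorem star_add (f g h : PowerSeries (Polynomial ℂ)) :
    star f (g + h) = star f g + star f h := by
  ext1 N
  simp [star, mul_add, Finset.sum_add_distrib]

theorem add_star (f g h : PowerSeries (Polynomial ℂ)) :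
    star (f + g) h = star f h + star g h := by
  ext1 N
  simp [star, add_mul, Finset.sum_add_distrib]

theorem smul_star (c : ℂ) (f g : PowerSeries (Polynomial ℂ)) :
    star (c • f) g = c • star f g := by
  ext1 N
  change _ = c • PowerSeries.coeff N (star f g)
  simp only [star, PowerSeries.coeff_mk]
  rw [map_sum, map_sum, Finset.smul_sum]
  refine Finset.sum_congr rfl fun j _ => ?_
  have h : ∀ u : PowerSeries (Polynomial ℂ),
      PowerSeries.coeff N (c • u) = c • PowerSeries.coeff N u := fun u => rfl
  rw [(dA ^ j).map_smul, smul_mul_assoc, smul_comm, h]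

theorem star_smul (c : ℂ) (f g : PowerSeries (Polynomial ℂ)) :
    star f (c • g) = c • star f g := by
  ext1 N
  change _ = c • PowerSeries.coeff N (star f g)
  simp only [star, PowerSeries.coeff_mk]
  rw [map_sum, map_sum, Finset.smul_sum]
  refine Finset.sum_congr rfl fun j _ => ?_
  have h : ∀ u : PowerSeries (Polynomial ℂ),
      PowerSeries.coeff N (c • u) = c • PowerSeries.coeff N u := fun u => rfl
  rw [(dB ^ j).map_smul, mul_smul_comm, smul_comm, h]

/-- If `∂f/∂a = 0`, i.e. if `f` is a series in `b`, then `f ⋆ g` is the commutative product. -/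
theorem star_of_dA_eq_zero {f : PowerSeries (Polynomial ℂ)} (hf : dA f = 0)
    (g : PowerSeries (Polynomial ℂ)) : star f g = f * g := by
  ext1 N
  rw [star, PowerSeries.coeff_mk, Finset.sum_range_succ', Finset.sum_eq_zero]
  · simp
  · intro j _
    rw [pow_succ, Module.End.mul_apply, hf, map_zero, zero_mul, smul_zero]

/-- If `∂g/∂b = 0`, i.e. if `g` is a polynomial in `a`, then `f ⋆ g` is the commutative product. -/
theorem star_of_dB_eq_zero {g : PowerSeries (Polynomial ℂ)} (hg : dB g = 0)
    (f : PowerSeries (Polynomial ℂ)) : star f g = f * g := by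
  ext1 N
  rw [star, PowerSeries.coeff_mk, Finset.sum_range_succ', Finset.sum_eq_zero]
  · simp
  · intro j _
    rw [pow_succ dB, Module.End.mul_apply, hg, map_zero, mul_zero, smul_zero]

theorem dA_one : dA 1 = 0 := by
  ext1 n
  by_cases h : n = 0 <;> simp [dA, PowerSeries.coeff_one, h]

theorem dB_one : dB 1 = 0 := by
  simp [dB]

instance : Mul ABAlgebra := ⟨fun f g => star f g⟩

instance : One ABAlgebra := ⟨(1 : PowerSeries (Polynomial ℂ))⟩

instance : Ring ABAlgebra :=
  { (inferInstance : AddCommGroup ABAlgebra) with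
    mul := (· * ·)
    one := 1
    mul_assoc := star_assoc
    one_mul := fun f => (star_of_dA_eq_zero dA_one f).trans (one_mul (M := PowerSeries _) f)
    mul_one := fun f => (star_of_dB_eq_zero dB_one f).trans (mul_one (M := PowerSeries _) f)
    left_distrib := star_add
    right_distrib := add_star
    zero_mul := fun f => by
      have h := add_star 0 0 f
      rw [add_zero] at h
      exact left_eq_add.1 h
    mul_zero := fun f => by
      have h := star_add f 0 0
      rw [add_zero] at h
      exact left_eq_add.1 h }

instance : Algebra ℂ ABAlgebra := Algebra.ofModule smul_star fun c f g => star_smul c f g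

/-- The polynomial `P_ν` in the expansion `f = ∑ b^ν P_ν(a)`. -/
def coeffB (ν : ℕ) (f : ABAlgebra) : Polynomial ℂ :=
  PowerSeries.coeff (R := Polynomial ℂ) ν f

/-- The generator `a`. -/
def a : ABAlgebra := PowerSeries.C (R := Polynomial ℂ) Polynomial.X

/-- The generator `b`. -/
def b : ABAlgebra := PowerSeries.X (R := Polynomial ℂ)

theorem dA_map_C (S : PowerSeries ℂ) : dA (PowerSeries.map Polynomial.C S) = 0 := by
  ext1 n
  simp [dA]

/-- The embedding `ℂ[[b]] → Ã`. -/
def ofSeries : PowerSeries ℂ →+* ABAlgebra where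
  toFun S := PowerSeries.map Polynomial.C S
  map_one' := map_one (PowerSeries.map (Polynomial.C (R := ℂ)))
  map_mul' S T := (map_mul (PowerSeries.map (Polynomial.C (R := ℂ))) S T).trans
    (star_of_dA_eq_zero (dA_map_C S) _).symm
  map_zero' := map_zero (PowerSeries.map (Polynomial.C (R := ℂ)))
  map_add' := map_add (PowerSeries.map (Polynomial.C (R := ℂ)))

/-- The defining commutation relation. -/
theorem a_mul_b_sub_b_mul_a : a * b - b * a = b ^ 2 := by
  have hA : dA (PowerSeries.X (R := Polynomial ℂ)) = 0 := by
    ext1 n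
    by_cases h : n = 1 <;> simp [dA, PowerSeries.coeff_X, h]
  have hba : b * a = (PowerSeries.X * PowerSeries.C Polynomial.X : PowerSeries (Polynomial ℂ)) :=
    star_of_dA_eq_zero hA _
  have hbb : b * b = (PowerSeries.X ^ 2 : PowerSeries (Polynomial ℂ)) :=
    (star_of_dA_eq_zero hA _).trans (pow_two _).symm
  have hdA : dA (PowerSeries.C (R := Polynomial ℂ) Polynomial.X) = 1 := by
    ext1 n
    by_cases h : n = 0 <;> simp [dA, PowerSeries.coeff_C, PowerSeries.coeff_one, h]
  have hdB : dB (PowerSeries.X (R := Polynomial ℂ)) = PowerSeries.X ^ 2 := by simp [dB]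
  have hab : a * b = (PowerSeries.X * PowerSeries.C Polynomial.X + PowerSeries.X ^ 2 :
      PowerSeries (Polynomial ℂ)) := by
    change star (PowerSeries.C Polynomial.X) PowerSeries.X = _
    ext1 N
    rw [coeff_star (show N < N + 2 by omega), mulTo, Finset.sum_range_succ',
      Finset.sum_range_succ', Finset.sum_eq_zero]
    · simp [hdA, hdB, mul_comm, add_comm]
    · intro j _
      rw [add_assoc, pow_add, pow_two dA, Module.End.mul_apply, Module.End.mul_apply, hdA, dA_one,
        map_zero, zero_mul, smul_zero]
  rw [sub_eq_iff_eq_add', pow_two, hab, hba, hbb]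
  rfl

/-- `x` is homogeneous of degree `k` in `(a, b)` and monic in `a`:
`x = ∑_{j ≤ k} c_j a^j b^{k-j}` with `c_k = 1`. -/
def IsMonicHomogeneous (k : ℕ) (x : ABAlgebra) : Prop :=
  ∃ c : ℕ → ℂ, c k = 1 ∧ x = ∑ j ∈ Finset.range (k + 1), c j • (a ^ j * b ^ (k - j))

/-- `x` is a polynomial in `a` of degree `< d` with coefficients in `ℂ[[b]]`. For `d = 0` this
means `x = 0`. -/
def IsPolyDegreeLT (d : ℕ) (x : ABAlgebra) : Prop :=
  ∃ S : ℕ → PowerSeries ℂ, x = ∑ j ∈ Finset.range d, ofSeries (S j) * a ^ j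

/-- The valuation of `x` in `(a, b)` is at least `n`: only monomials `b^ν a^i` with `ν + i ≥ n`
occur in `x`. -/
def HasValuationGE (n : ℤ) (x : ABAlgebra) : Prop :=
  ∀ ν i : ℕ, (ν : ℤ) + i < n → (coeffB ν x).coeff i = 0

/-- The homogeneous part of degree `n` in `(a, b)` of `x`: the sum of the terms
`c_{ν,i} b^ν a^i` of `x` with `ν + i = n`. It is `0` if `n < 0`. -/
def homPart (n : ℤ) (x : ABAlgebra) : ABAlgebra :=
  if 0 ≤ n then
    ∑ p ∈ Finset.HasAntidiagonal.antidiagonal n.toNat, (coeffB p.1 x).coeff p.2 • (b ^ p.1 * a ^ p.2)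
  else 0

end ABAlgebra

open ABAlgebra in
/-- The `ℂ[[b]]`-module underlying a left `Ã`-module. -/
abbrev bModule (E : Type*) [AddCommGroup E] [Module ABAlgebra E] : Module (PowerSeries ℂ) E :=
  Module.compHom E ofSeries

/-- An (a,b)-module: a left `Ã`-module that is free of finite type over `ℂ[[b]]`. -/
def IsABModule (E : Type*) [AddCommGroup E] [Module ABAlgebra E] : Prop :=
  letI := bModule E
  Module.Free (PowerSeries ℂ) E ∧ Module.Finite (PowerSeries ℂ) E

/-- The rank over `ℂ[[b]]`. -/
def abRank (E : Type*) [AddCommGroup E] [Module ABAlgebra E] : ℕ :=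
  letI := bModule E
  Module.finrank (PowerSeries ℂ) E

/-- Simple pole: `a E ⊆ b E`. -/
def HasSimplePole (E : Type*) [AddCommGroup E] [Module ABAlgebra E] : Prop :=
  ∀ y : E, ∃ z : E, ABAlgebra.a • y = ABAlgebra.b • z

/-- A regular (a,b)-module: one that embeds in an (a,b)-module with a simple pole. Equivalently,
its saturation by `b⁻¹ a` in `E[b⁻¹]` is of finite type over `ℂ[[b]]`. -/
def IsRegularABModule.{u} (E : Type u) [AddCommGroup E] [Module ABAlgebra E] : Prop :=
  IsABModule E ∧ ∃ (F : Type u) (_ : AddCommGroup F) (_ : Module ABAlgebra F),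
    IsABModule F ∧ HasSimplePole F ∧ ∃ f : E →ₗ[ABAlgebra] F, Function.Injective f

/-- `E` is isomorphic to `Ã ⧸ I` for some left ideal `I`. -/
def IsMonogenic (E : Type*) [AddCommGroup E] [Module ABAlgebra E] : Prop :=
  ∃ I : Submodule ABAlgebra ABAlgebra, Nonempty (E ≃ₗ[ABAlgebra] (ABAlgebra ⧸ I))

/-- `E` is isomorphic, as a left module, to `Ã ⧸ Ã x`. -/
def IsPresentedBy (E : Type*) [AddCommGroup E] [Module ABAlgebra E] (x : ABAlgebra) : Prop :=
  Nonempty (E ≃ₗ[ABAlgebra] (ABAlgebra ⧸ Submodule.span ABAlgebra {x}))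

open ABAlgebra in
/-- `P` is the Bernstein element of the monogenic regular (a,b)-module `E` of rank `k`: it is
homogeneous of degree `k`, monic in `a`, and `E ≃ Ã ⧸ Ã (P + b² R)` where `R` is a polynomial in
`a` of degree `≤ k - 1` over `ℂ[[b]]`, of valuation `≥ k - 1` in `(a, b)`. -/
def IsBernsteinElement (E : Type*) [AddCommGroup E] [Module ABAlgebra E] (P : ABAlgebra) : Prop :=
  IsMonicHomogeneous (abRank E) P ∧ ∃ R : ABAlgebra,
    IsPolyDegreeLT (abRank E) R ∧ HasValuationGE ((abRank E : ℤ) - 1) R ∧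
      IsPresentedBy E (P + b ^ 2 * R)

open ABAlgebra in
/-- `x = P + b³ S` presents `E`, where `S` is a polynomial in `a` of degree `≤ k - 1` over
`ℂ[[b]]`, of valuation `≥ k - 2` in `(a, b)`, with `k` the rank of `E`. -/
def IsReducedPresentation (E : Type*) [AddCommGroup E] [Module ABAlgebra E]
    (P S : ABAlgebra) : Prop :=
  IsPolyDegreeLT (abRank E) S ∧ HasValuationGE ((abRank E : ℤ) - 2) S ∧
    IsPresentedBy E (P + b ^ 3 * S)

end

/-! The algebra acts on `ℂ[[b]]`, identified with `Ã ⧸ Ã a`, by `a b^s = s b^(s+1)`. A homogeneous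
element of degree `n` sends `b^s` to `p(s) b^(s+n)` for a polynomial `p`, its symbol `symb n`.
Symbols determine an element, the degree of `p` is the degree in `a`, and products become shifted
products: `p(X + q) r(X)` when the right factor `r` has degree `q` (`symb_mul`). Graded questions
about `Ã` thus become questions about polynomials in one variable.

Existence: a generator `e` of `E`, viewed in a module with a simple pole, is killed by some `Q` of
valuation at least `N` with `Q = a^N` modulo `b`. Hence `a^N e ∈ bE`. If `m` is minimal with `a^m e
∈ bE`, then `e, ..., a^(m-1) e` is a basis over `ℂ[[b]]`, so `m = k` and the annihilator of `e` is
`Ã x` with `x` monic of degree `k` in `a`. Since `x` divides `Q` and valuations add, `x` has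
valuation at least `k` (`exists_presentation`). Its part of degree `k` is `P`; what remains has
valuation above `k` and degree below `k` in `a`, so `b²` divides it.

Comparison: an isomorphism between two presentations gives `x u = v x'`, where `u` has a non-zero
constant term if `k > 0`. In degree `k` this shows that `P` is unique. In degree `k + 1` the linear
parts of `u` and `v` must agree, and the two components differ by a commutator of `P` with a linear
element (`exists_commSymb_of_mul_eq_mul`).

Normalisation: conjugating by `1 + β b` adds `[P, β b]` in degree `k + 1`, whose coefficient of `b²
a^(k-1)` is `β k`; a suitable `β` leaves a multiple of `b³`. Two such normal forms differ by a
commutator of degree at most `k - 2` in `a`. This condition is one linear equation in `(α, β)` with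
coefficient `k ≠ 0` at `β`, so it cuts out a line. -/

noncomputable section

open Polynomial

namespace ABAlgebra

/-! ### Coefficients -/

/-- The series `∑ b^ν P_ν(a)` in commuting variables underlying an element of `Ã`. -/
def toPS (f : ABAlgebra) : PowerSeries ℂ[X] := f

/-- The element of `Ã` with a given underlying series. -/
def ofPS (f : PowerSeries ℂ[X]) : ABAlgebra := f

theorem toPS_mul (f g : ABAlgebra) : toPS (f * g) = star (toPS f) (toPS g) := rfl

theorem coeffB_eq (ν : ℕ) (f : ABAlgebra) : coeffB ν f = PowerSeries.coeff ν (toPS f) := rfl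

theorem ext_coeffB {f g : ABAlgebra} (h : ∀ ν, coeffB ν f = coeffB ν g) : f = g :=
  PowerSeries.ext (R := ℂ[X]) h

@[simp] theorem coeffB_add (ν : ℕ) (f g : ABAlgebra) :
    coeffB ν (f + g) = coeffB ν f + coeffB ν g :=
  map_add (PowerSeries.coeff (R := ℂ[X]) ν) f g

@[simp] theorem coeffB_sub (ν : ℕ) (f g : ABAlgebra) :
    coeffB ν (f - g) = coeffB ν f - coeffB ν g :=
  map_sub (PowerSeries.coeff (R := ℂ[X]) ν) f g

@[simp] theorem coeffB_zero (ν : ℕ) : coeffB ν 0 = 0 :=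
  map_zero (PowerSeries.coeff (R := ℂ[X]) ν)

@[simp] theorem coeffB_smul (ν : ℕ) (c : ℂ) (f : ABAlgebra) :
    coeffB ν (c • f) = c • coeffB ν f := rfl

@[simp] theorem coeffB_sum {ι : Type*} (s : Finset ι) (ν : ℕ) (f : ι → ABAlgebra) :
    coeffB ν (∑ i ∈ s, f i) = ∑ i ∈ s, coeffB ν (f i) :=
  map_sum (PowerSeries.coeff (R := ℂ[X]) ν) f s

theorem coeffB_one (ν : ℕ) : coeffB ν 1 = if ν = 0 then 1 else 0 :=
  PowerSeries.coeff_one (R := ℂ[X]) ν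

theorem coeffB_mk (F : ℕ → ℂ[X]) (ν : ℕ) : coeffB ν (ofPS (PowerSeries.mk F)) = F ν :=
  PowerSeries.coeff_mk ν F

theorem coeffB_ofSeries (ν : ℕ) (S : PowerSeries ℂ) :
    coeffB ν (ofSeries S) = C (PowerSeries.coeff ν S) :=
  PowerSeries.coeff_map C ν S

theorem b_eq_ofSeries : b = ofSeries PowerSeries.X := (PowerSeries.map_X C).symm

theorem b_pow_eq_ofSeries (n : ℕ) : b ^ n = ofSeries (PowerSeries.X ^ n) := by
  rw [map_pow, b_eq_ofSeries]

theorem toPS_b_pow (n : ℕ) : toPS (b ^ n) = PowerSeries.X ^ n := by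
  rw [b_pow_eq_ofSeries]
  exact (map_pow (PowerSeries.map C) _ _).trans (by rw [PowerSeries.map_X])

theorem toPS_ofSeries_mul (S : PowerSeries ℂ) (f : ABAlgebra) :
    toPS (ofSeries S * f) = PowerSeries.map C S * toPS f :=
  star_of_dA_eq_zero (dA_map_C S) f

theorem coeffB_b_pow_mul (d ν : ℕ) (f : ABAlgebra) :
    coeffB ν (b ^ d * f) = if d ≤ ν then coeffB (ν - d) f else 0 := by
  rw [b_pow_eq_ofSeries, coeffB_eq, toPS_ofSeries_mul, map_pow, PowerSeries.map_X,
    PowerSeries.coeff_X_pow_mul']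
  rfl

theorem coeffB_b_pow_mul_add (d ν : ℕ) (f : ABAlgebra) :
    coeffB (ν + d) (b ^ d * f) = coeffB ν f := by
  simp [coeffB_b_pow_mul]

theorem coeffB_succ_b_mul (ν : ℕ) (f : ABAlgebra) : coeffB (ν + 1) (b * f) = coeffB ν f := by
  simpa using coeffB_b_pow_mul_add 1 ν f

theorem coeffB_b_pow (d ν : ℕ) : coeffB ν (b ^ d) = if ν = d then 1 else 0 := by
  rw [coeffB_eq, toPS_b_pow, PowerSeries.coeff_X_pow]

theorem dB_C (p : ℂ[X]) : dB (PowerSeries.C p) = 0 := by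
  simp [dB]

/-- The embedding `ℂ[a] → Ã`. -/
def ofPoly : ℂ[X] →+* ABAlgebra where
  toFun p := ofPS (PowerSeries.C p)
  map_one' := map_one PowerSeries.C
  map_mul' p q := (map_mul PowerSeries.C p q).trans (star_of_dB_eq_zero (dB_C q) _).symm
  map_zero' := map_zero PowerSeries.C
  map_add' := map_add PowerSeries.C

@[simp] theorem ofPoly_X : ofPoly X = a := rfl

theorem coeffB_ofPoly (ν : ℕ) (p : ℂ[X]) : coeffB ν (ofPoly p) = if ν = 0 then p else 0 :=
  PowerSeries.coeff_C (R := ℂ[X]) ν p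

theorem coeffB_mul_ofPoly (ν : ℕ) (f : ABAlgebra) (p : ℂ[X]) :
    coeffB ν (f * ofPoly p) = coeffB ν f * p := by
  have h : toPS (f * ofPoly p) = toPS f * PowerSeries.C p := star_of_dB_eq_zero (dB_C p) _
  rw [coeffB_eq, h, PowerSeries.coeff_mul_C, coeffB_eq]

theorem coeffB_mul_a_pow (ν i : ℕ) (f : ABAlgebra) :
    coeffB ν (f * a ^ i) = coeffB ν f * X ^ i := by
  rw [← ofPoly_X, ← map_pow, coeffB_mul_ofPoly]

theorem coeffB_zero_mul (f g : ABAlgebra) : coeffB 0 (f * g) = coeffB 0 f * coeffB 0 g := by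
  rw [coeffB_eq, toPS_mul, star, PowerSeries.coeff_mk]
  simp [coeffB_eq]

/-- Reduction modulo `b`, as a ring homomorphism. -/
def modB : ABAlgebra →+* ℂ[X] where
  toFun := coeffB 0
  map_one' := by simp [coeffB_one]
  map_mul' := coeffB_zero_mul
  map_zero' := coeffB_zero 0
  map_add' := coeffB_add 0

theorem modB_apply (f : ABAlgebra) : modB f = coeffB 0 f := rfl

@[simp] theorem modB_a : modB a = X := by simp [modB_apply, ← ofPoly_X, coeffB_ofPoly]

@[simp] theorem modB_b : modB b = 0 := by
  rw [modB_apply, ← pow_one b, coeffB_b_pow]; simp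

@[simp] theorem modB_ofPoly (p : ℂ[X]) : modB (ofPoly p) = p := by
  simp [modB_apply, coeffB_ofPoly]

theorem modB_smul (c : ℂ) (f : ABAlgebra) : modB (c • f) = c • modB f := rfl

theorem exists_eq_b_pow_mul (d : ℕ) {f : ABAlgebra} (h : ∀ ν < d, coeffB ν f = 0) :
    ∃ g, f = b ^ d * g := by
  refine ⟨ofPS (PowerSeries.mk fun ν => coeffB (ν + d) f), ext_coeffB fun ν => ?_⟩
  rw [coeffB_b_pow_mul]
  split_ifs with hd
  · rw [coeffB_mk, Nat.sub_add_cancel hd]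
  · exact h ν (not_le.1 hd)

theorem exists_eq_add_b_mul (f : ABAlgebra) : ∃ g, f = ofPoly (modB f) + b * g := by
  obtain ⟨g, hg⟩ := exists_eq_b_pow_mul 1 (f := f - ofPoly (modB f)) fun ν hν => by
    obtain rfl : ν = 0 := by omega
    simp [coeffB_ofPoly, modB_apply]
  exact ⟨g, by rw [pow_one] at hg; rw [← hg]; abel⟩

/-- An element divisible by all powers of `b` is zero. -/
theorem eq_zero_of_forall_dvd {f : ABAlgebra} (h : ∀ n, ∃ g, f = b ^ n * g) : f = 0 := by
  refine ext_coeffB fun ν => ?_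
  obtain ⟨g, hg⟩ := h (ν + 1)
  rw [hg, coeffB_b_pow_mul]
  simp

/-- Coefficient of `b^ν a^i`. -/
abbrev cf (ν i : ℕ) (f : ABAlgebra) : ℂ := (coeffB ν f).coeff i

/-! ### The action on `ℂ[[b]]` and symbols -/

/-- The homogeneous part of degree `n` is `bⁿ p(D)` with `D = b⁻¹ a`; this is the polynomial `p`. -/
def symb (n : ℕ) (f : ABAlgebra) : ℂ[X] :=
  ∑ p ∈ Finset.HasAntidiagonal.antidiagonal n, cf p.1 p.2 f • ascPochhammer ℂ p.2

/-- Each application of `b² ∂/∂b` sends `b^m` to `m b^(m+1)`, so the `j`-th power produces the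
rising factorial `m (m+1) ... (m+j-1)`. This is where the Pochhammer polynomials in symbols come
from. -/
theorem coeff_dB_pow (j q : ℕ) (h : PowerSeries ℂ[X]) :
    PowerSeries.coeff q ((dB ^ j) h)
      = PowerSeries.coeff q (PowerSeries.X ^ j *
          PowerSeries.mk fun m => ((ascPochhammer ℂ j).eval (m : ℂ)) • PowerSeries.coeff m h) := by
  induction j generalizing q with
  | zero => simp
  | succ j ih =>
    rw [pow_succ', Module.End.mul_apply]
    have hd : ∀ u : PowerSeries ℂ[X], PowerSeries.coeff q (dB u)
        = if 1 ≤ q then ((q - 1 : ℕ) : ℂ) • PowerSeries.coeff (q - 1) u else 0 := by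
      intro u
      rcases q with _ | _ | q
      · simp [dB, PowerSeries.coeff_X_pow_mul']
      · simp [dB, PowerSeries.coeff_X_pow_mul']
      · simp [dB, PowerSeries.coeff_X_pow_mul', PowerSeries.coeff_derivative, Algebra.smul_def]
        ring
    rw [hd, ih, PowerSeries.coeff_X_pow_mul', PowerSeries.coeff_X_pow_mul']
    by_cases hq : j + 1 ≤ q
    · rw [if_pos (by omega), if_pos (by omega), if_pos hq]
      simp only [PowerSeries.coeff_mk]
      rw [smul_smul, ascPochhammer_succ_eval, show q - 1 - j = q - (j + 1) by omega]
      congr 1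
      rw [mul_comm]
      congr 1
      have : q - 1 = q - (j + 1) + j := by omega
      rw [this]; push_cast; ring
    · rw [if_neg hq]
      split_ifs with h1 h2
      · omega
      · simp
      · rfl

theorem coeff_dA_pow (j q : ℕ) (f : PowerSeries ℂ[X]) :
    PowerSeries.coeff q ((dA ^ j) f) = derivative^[j] (PowerSeries.coeff q f) := by
  induction j with
  | zero => simp
  | succ j ih =>
    rw [pow_succ', Module.End.mul_apply, Function.iterate_succ_apply', ← ih]
    simp [dA]

theorem coeff_zero_dA_pow (j q : ℕ) (f : ABAlgebra) :
    (PowerSeries.coeff q ((dA ^ j) (toPS f))).coeff 0 = (j.factorial : ℂ) * cf q j f := by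
  rw [coeff_dA_pow, Polynomial.coeff_iterate_derivative]
  simp only [zero_add, Nat.descFactorial_self, nsmul_eq_mul]
  rfl

/-- The action of `Ã` on `ℂ[[b]] = Ã ⧸ Ã a`. -/
theorem cf_mul_zero (N : ℕ) (f h : ABAlgebra) :
    cf N 0 (f * h) = ∑ x ∈ Finset.HasAntidiagonal.antidiagonal N,
      (symb x.1 f).eval (x.2 : ℂ) * cf x.2 0 h := by
  have h1 : cf N 0 (f * h) = ∑ j ∈ Finset.range (N + 1),
      ∑ x ∈ Finset.HasAntidiagonal.antidiagonal (N - j),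
        cf x.1 j f * ((ascPochhammer ℂ j).eval (x.2 : ℂ) * cf x.2 0 h) := by
    rw [cf, coeffB_eq, toPS_mul, star, PowerSeries.coeff_mk, map_sum, Polynomial.finsetSum_coeff]
    refine Finset.sum_congr rfl fun j hj => ?_
    have hmul : ∀ u : PowerSeries ℂ[X], PowerSeries.coeff N (u * (dB ^ j) (toPS h))
        = PowerSeries.coeff N (PowerSeries.X ^ j * (u *
          PowerSeries.mk fun m => ((ascPochhammer ℂ j).eval (m : ℂ)) • PowerSeries.coeff m (toPS h))) := by
      intro u
      have : (dB ^ j) (toPS h) = PowerSeries.X ^ j * (PowerSeries.mk fun m =>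
          ((ascPochhammer ℂ j).eval (m : ℂ)) • PowerSeries.coeff m (toPS h)) :=
        PowerSeries.ext fun q => coeff_dB_pow j q _
      rw [this]
      congr 1
      simp only [← mul_assoc, mul_comm]
    have hs : ∀ u : PowerSeries ℂ[X], PowerSeries.coeff N (((j.factorial : ℂ)⁻¹) • u)
        = ((j.factorial : ℂ)⁻¹) • PowerSeries.coeff N u := fun _ => rfl
    rw [hs, hmul, PowerSeries.coeff_X_pow_mul', if_pos (by simpa [Nat.lt_succ_iff] using hj),
      PowerSeries.coeff_mul, Polynomial.coeff_smul, Polynomial.finsetSum_coeff, Finset.smul_sum]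
    refine Finset.sum_congr rfl fun x _ => ?_
    rw [Polynomial.mul_coeff_zero, coeff_zero_dA_pow, PowerSeries.coeff_mk, Polynomial.coeff_smul]
    have : (j.factorial : ℂ) ≠ 0 := by exact_mod_cast j.factorial_ne_zero
    simp only [smul_eq_mul]
    field_simp
    rfl
  rw [h1, Finset.sum_sigma']
  have h2 : ∀ x ∈ Finset.HasAntidiagonal.antidiagonal N,
      (symb x.1 f).eval (x.2 : ℂ) * cf x.2 0 h
        = ∑ y ∈ Finset.HasAntidiagonal.antidiagonal x.1,
          cf y.1 y.2 f * ((ascPochhammer ℂ y.2).eval (x.2 : ℂ) * cf x.2 0 h) := by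
    intro x _
    rw [symb, eval_finsetSum, Finset.sum_mul]
    refine Finset.sum_congr rfl fun y _ => ?_
    rw [eval_smul, smul_eq_mul, mul_assoc]
  rw [Finset.sum_congr rfl h2, Finset.sum_sigma']
  -- Both sides run over triples with sum `N`: power of `b` in `f`, power of `a` in `f`, power of
  -- `b` in `h`. Only the grouping differs.
  refine Finset.sum_nbij' (fun x => ⟨(x.2.1 + x.1, x.2.2), (x.2.1, x.1)⟩)
    (fun x => ⟨x.2.2, (x.2.1, x.1.2)⟩) ?_ ?_ ?_ ?_ ?_
  · rintro ⟨j, p, q⟩ hx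
    simp only [Finset.mem_sigma, Finset.mem_range, Finset.HasAntidiagonal.mem_antidiagonal] at hx ⊢
    exact ⟨by omega, trivial⟩
  · rintro ⟨⟨p, q⟩, r, s⟩ hx
    simp only [Finset.mem_sigma, Finset.mem_range, Finset.HasAntidiagonal.mem_antidiagonal] at hx ⊢
    omega
  · rintro ⟨j, p, q⟩ hx
    rfl
  · rintro ⟨⟨p, q⟩, r, s⟩ hx
    simp only [Finset.mem_sigma, Finset.HasAntidiagonal.mem_antidiagonal] at hx
    obtain ⟨_, rfl⟩ := hx
    rfl
  · rintro ⟨j, p, q⟩ _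
    rfl

theorem sum_antidiagonal_add_ite {M : Type*} [AddCommMonoid M] (n s : ℕ) (F : ℕ → ℕ → M) :
    ∑ x ∈ Finset.HasAntidiagonal.antidiagonal (n + s), (if s ≤ x.2 then F x.1 (x.2 - s) else 0)
      = ∑ x ∈ Finset.HasAntidiagonal.antidiagonal n, F x.1 x.2 := by
  rw [← Finset.sum_filter]
  refine Finset.sum_nbij' (fun x => (x.1, x.2 - s)) (fun x => (x.1, x.2 + s)) ?_ ?_ ?_ ?_ ?_
  · rintro ⟨p, q⟩ hx
    simp only [Finset.mem_filter, Finset.HasAntidiagonal.mem_antidiagonal] at hx ⊢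
    omega
  · rintro ⟨p, q⟩ hx
    simp only [Finset.mem_filter, Finset.HasAntidiagonal.mem_antidiagonal] at hx ⊢
    omega
  · rintro ⟨p, q⟩ hx
    simp only [Finset.mem_filter, Finset.HasAntidiagonal.mem_antidiagonal] at hx
    simp only [Prod.mk.injEq, true_and]
    omega
  · rintro ⟨p, q⟩ _
    simp
  · rintro ⟨p, q⟩ _
    rfl

theorem cf_mul_b_pow_zero (N s : ℕ) (f : ABAlgebra) :
    cf N 0 (f * b ^ s) = if s ≤ N then (symb (N - s) f).eval (s : ℂ) else 0 := by
  rw [cf_mul_zero]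
  have h : ∀ x ∈ Finset.HasAntidiagonal.antidiagonal N,
      (symb x.1 f).eval (x.2 : ℂ) * cf x.2 0 (b ^ s)
        = if x = (N - s, s) then (if s ≤ N then (symb (N - s) f).eval (s : ℂ) else 0) else 0 := by
    rintro ⟨p, q⟩ hx
    have hx := Finset.HasAntidiagonal.mem_antidiagonal.1 hx
    simp only at hx
    simp only [cf, coeffB_b_pow, Prod.mk.injEq]
    by_cases hq : q = s
    · subst hq
      simp [show q ≤ N by omega, show p = N - q by omega]
    · simp [hq]
  rw [Finset.sum_congr rfl h, Finset.sum_ite_eq']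
  split_ifs with h1 h2 <;> first | rfl | (simp at h1; omega)

/-- It suffices to compare values at natural numbers `s`, which are coefficients of `f g` acting on
`b^s`. The degree `q` part of `g` acts first and moves `b^s` to `b^(s+q)`, so the symbol of `f` is
evaluated at `s + q`. -/
theorem symb_mul (n : ℕ) (f g : ABAlgebra) :
    symb n (f * g) = ∑ x ∈ Finset.HasAntidiagonal.antidiagonal n,
      (symb x.1 f).comp (X + C (x.2 : ℂ)) * symb x.2 g := by
  refine Polynomial.eq_of_infinite_eval_eq _ _ (Set.Infinite.mono (s := Set.range ((↑) : ℕ → ℂ)) ?_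
    (Set.infinite_range_of_injective Nat.cast_injective))
  rintro _ ⟨s, rfl⟩
  have h1 := cf_mul_b_pow_zero (n + s) s (f * g)
  rw [if_pos (by omega), Nat.add_sub_cancel, mul_assoc, cf_mul_zero] at h1
  rw [Set.mem_ofPred_eq, ← h1, eval_finsetSum, ← sum_antidiagonal_add_ite n s fun p q =>
    ((symb p f).comp (X + C (q : ℂ)) * symb q g).eval (s : ℂ)]
  refine Finset.sum_congr rfl fun x _ => ?_
  rw [cf_mul_b_pow_zero]
  split_ifs with hs
  · simp only [eval_mul, eval_comp, eval_add, eval_X, eval_C]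
    congr 3
    rw [← Nat.cast_add]
    congr 1
    omega
  · rw [mul_zero]

@[simp] theorem symb_add (n : ℕ) (f g : ABAlgebra) : symb n (f + g) = symb n f + symb n g := by
  simp [symb, cf, add_smul, Finset.sum_add_distrib]

@[simp] theorem symb_sub (n : ℕ) (f g : ABAlgebra) : symb n (f - g) = symb n f - symb n g := by
  simp [symb, cf, sub_smul, Finset.sum_sub_distrib]

@[simp] theorem symb_zero (n : ℕ) : symb n 0 = 0 := by simp [symb, cf]

@[simp] theorem symb_smul (n : ℕ) (c : ℂ) (f : ABAlgebra) : symb n (c • f) = c • symb n f := by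
  simp [symb, cf, mul_smul, Finset.smul_sum]

@[simp] theorem symb_sum {ι : Type*} (s : Finset ι) (n : ℕ) (f : ι → ABAlgebra) :
    symb n (∑ i ∈ s, f i) = ∑ i ∈ s, symb n (f i) := by
  induction s using Finset.cons_induction with
  | empty => simp
  | cons i s hi ih => simp [Finset.sum_cons, ih]

theorem coeff_symb {n d : ℕ} (hd : d ≤ n) {f : ABAlgebra}
    (h : ∀ ν i, ν + i = n → d < i → cf ν i f = 0) : (symb n f).coeff d = cf (n - d) d f := by
  rw [symb, finsetSum_coeff, Finset.sum_eq_single (n - d, d)]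
  · have := (monic_ascPochhammer ℂ d).coeff_natDegree
    rw [ascPochhammer_natDegree] at this
    simp [this]
  · rintro ⟨ν, i⟩ hx hne
    have hx := Finset.HasAntidiagonal.mem_antidiagonal.1 hx
    simp only at hx
    rcases lt_trichotomy i d with hi | rfl | hi
    · rw [coeff_smul, coeff_eq_zero_of_natDegree_lt, smul_zero]
      simpa using hi
    · exact (hne (Prod.ext (by simp only; omega) rfl)).elim
    · simp only
      rw [h ν i hx hi, zero_smul, coeff_zero]
  · intro hx
    exact absurd (Finset.HasAntidiagonal.mem_antidiagonal.2 (by simp; omega)) hx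

/-- Rising factorials are monic with one in each degree, so passing from powers of `a` to symbols is
unitriangular and preserves the degree filtration. -/
theorem degree_symb_lt_iff {n d : ℕ} {f : ABAlgebra} :
    (symb n f).degree < d ↔ ∀ ν i, ν + i = n → d ≤ i → cf ν i f = 0 := by
  constructor
  · intro h ν
    -- As `ν + i = n`, this is a descending induction on the power of `a`: the highest surviving
    -- term is the leading coefficient of the symbol.
    induction ν using Nat.strong_induction_on with
    | _ ν ih =>
      intro i hi hd
      have := coeff_symb (n := n) (d := i) (f := f) (by omega) fun μ l hl hil =>
        ih μ (by omega) l hl (by omega)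
      rw [show ν = n - i by omega, ← this]
      exact coeff_eq_zero_of_degree_lt (h.trans_le (by exact_mod_cast hd))
  · intro h
    rw [← mem_degreeLT]
    refine Submodule.sum_mem _ ?_
    rintro ⟨ν, i⟩ hx
    have hx := Finset.HasAntidiagonal.mem_antidiagonal.1 hx
    by_cases hi : d ≤ i
    · simp only
      rw [h ν i hx hi, zero_smul]
      exact Submodule.zero_mem _
    · refine Submodule.smul_mem _ _ (mem_degreeLT.2 ?_)
      refine degree_le_natDegree.trans_lt ?_
      rw [ascPochhammer_natDegree]
      exact_mod_cast not_le.1 hi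

theorem degree_symb_lt (n : ℕ) (f : ABAlgebra) : (symb n f).degree < (n + 1 : ℕ) :=
  degree_symb_lt_iff.2 fun ν i h hi => by omega

theorem symb_eq_zero_iff {n : ℕ} {f : ABAlgebra} :
    symb n f = 0 ↔ ∀ ν i, ν + i = n → cf ν i f = 0 := by
  have := degree_symb_lt_iff (n := n) (d := 0) (f := f)
  simpa using this

theorem eq_zero_of_symb {f : ABAlgebra} (h : ∀ n, symb n f = 0) : f = 0 :=
  ext_coeffB fun ν => Polynomial.ext fun i => by
    simpa using symb_eq_zero_iff.1 (h (ν + i)) ν i rfl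

theorem ext_symb {f g : ABAlgebra} (h : ∀ n, symb n f = symb n g) : f = g :=
  sub_eq_zero.1 (eq_zero_of_symb fun n => by rw [symb_sub, h, sub_self])

theorem isPolyDegreeLT_iff_cf {d : ℕ} {f : ABAlgebra} :
    IsPolyDegreeLT d f ↔ ∀ ν i, d ≤ i → cf ν i f = 0 := by
  constructor
  · rintro ⟨S, rfl⟩ ν i hi
    rw [cf, coeffB_sum, finsetSum_coeff]
    refine Finset.sum_eq_zero fun j hj => ?_
    rw [coeffB_mul_a_pow, coeffB_ofSeries, coeff_C_mul_X_pow, if_neg]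
    have := Finset.mem_range.1 hj
    omega
  · intro h
    refine ⟨fun j => PowerSeries.mk fun ν => cf ν j f, ext_coeffB fun ν => Polynomial.ext fun i => ?_⟩
    rw [coeffB_sum, finsetSum_coeff]
    have : ∀ j ∈ Finset.range d, (coeffB ν (ofSeries (PowerSeries.mk fun ν => cf ν j f) * a ^ j)).coeff i
        = if i = j then cf ν i f else 0 := by
      intro j _
      rw [coeffB_mul_a_pow, coeffB_ofSeries, coeff_C_mul_X_pow, PowerSeries.coeff_mk]
      split_ifs with hij
      · rw [hij]
      · rfl
    rw [Finset.sum_congr rfl this, Finset.sum_ite_eq]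
    split_ifs with hi
    · rfl
    · exact h ν i (by simpa using hi)

theorem isPolyDegreeLT_iff {d : ℕ} {f : ABAlgebra} :
    IsPolyDegreeLT d f ↔ ∀ n, (symb n f).degree < d := by
  simp only [isPolyDegreeLT_iff_cf, degree_symb_lt_iff]
  exact ⟨fun h n ν i _ => h ν i, fun h ν i => h (ν + i) ν i rfl⟩

theorem hasValuationGE_iff {n : ℤ} {f : ABAlgebra} :
    HasValuationGE n f ↔ ∀ m : ℕ, (m : ℤ) < n → symb m f = 0 := by
  simp only [HasValuationGE, symb_eq_zero_iff]
  constructor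
  · rintro h m hm ν i rfl
    exact h ν i (by exact_mod_cast hm)
  · intro h ν i hi
    exact h (ν + i) (by exact_mod_cast hi) ν i rfl

/-! ### Symbols of particular elements -/

theorem symb_b_pow_mul_a_pow (n p q : ℕ) :
    symb n (b ^ p * a ^ q) = if n = p + q then ascPochhammer ℂ q else 0 := by
  have hcf : ∀ ν i, cf ν i (b ^ p * a ^ q) = if ν = p ∧ i = q then 1 else 0 := by
    intro ν i
    rw [cf, coeffB_mul_a_pow, coeffB_b_pow]
    split_ifs with h1 h2 h2
    · simp [coeff_X_pow, h2]
    · simp [coeff_X_pow, show i ≠ q by tauto]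
    · exact absurd h2.1 h1
    · simp
  simp only [symb, hcf]
  split_ifs with h
  · rw [Finset.sum_eq_single (p, q)]
    · simp
    · rintro ⟨ν, i⟩ _ hne
      rw [if_neg (by simpa using hne), zero_smul]
    · intro hx
      exact absurd (Finset.HasAntidiagonal.mem_antidiagonal.2 h.symm) hx
  · refine Finset.sum_eq_zero ?_
    rintro ⟨ν, i⟩ hx
    have hx := Finset.HasAntidiagonal.mem_antidiagonal.1 hx
    rw [if_neg, zero_smul]
    rintro ⟨rfl, rfl⟩
    exact h hx.symm

theorem symb_b_pow (n d : ℕ) : symb n (b ^ d) = if n = d then 1 else 0 := by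
  simpa using symb_b_pow_mul_a_pow n d 0

theorem symb_one (n : ℕ) : symb n 1 = if n = 0 then 1 else 0 := by
  simpa using symb_b_pow n 0

theorem symb_a_pow (n d : ℕ) : symb n (a ^ d) = if n = d then ascPochhammer ℂ d else 0 := by
  simpa using symb_b_pow_mul_a_pow n 0 d

theorem symb_a (n : ℕ) : symb n a = if n = 1 then X else 0 := by
  simpa using symb_a_pow n 1

theorem symb_b (n : ℕ) : symb n b = if n = 1 then 1 else 0 := by
  simpa using symb_b_pow n 1

theorem symb_ofSeries (n : ℕ) (S : PowerSeries ℂ) :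
    symb n (ofSeries S) = C (PowerSeries.coeff n S) := by
  rw [symb, Finset.sum_eq_single (n, 0)]
  · simp [cf, coeffB_ofSeries, smul_eq_C_mul]
  · rintro ⟨ν, i⟩ hx hne
    have hx := Finset.HasAntidiagonal.mem_antidiagonal.1 hx
    simp only [ne_eq, Prod.mk.injEq] at hne hx
    simp only [cf, coeffB_ofSeries]
    rw [coeff_C_of_ne_zero (by omega), zero_smul]
  · intro hx
    exact absurd (Finset.HasAntidiagonal.mem_antidiagonal.2 (by simp)) hx

theorem symb_b_pow_mul_add (n d : ℕ) (f : ABAlgebra) : symb (n + d) (b ^ d * f) = symb n f := by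
  rw [symb_mul, Finset.sum_eq_single (d, n)]
  · simp [symb_b_pow]
  · rintro ⟨p, q⟩ hx hne
    have hx := Finset.HasAntidiagonal.mem_antidiagonal.1 hx
    simp only [ne_eq, Prod.mk.injEq] at hne hx
    simp only [symb_b_pow]
    rw [if_neg (by omega)]
    simp
  · intro hx
    exact absurd (Finset.HasAntidiagonal.mem_antidiagonal.2 (by simp [add_comm])) hx

theorem symb_b_pow_mul_of_lt {n d : ℕ} (h : n < d) (f : ABAlgebra) : symb n (b ^ d * f) = 0 := by
  rw [symb_mul]
  refine Finset.sum_eq_zero ?_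
  rintro ⟨p, q⟩ hx
  have hx := Finset.HasAntidiagonal.mem_antidiagonal.1 hx
  simp only at hx
  simp only [symb_b_pow]
  rw [if_neg (by omega)]
  simp

theorem symb_mul_of_lt {m n N : ℕ} {f g : ABAlgebra} (hf : ∀ i < m, symb i f = 0)
    (hg : ∀ i < n, symb i g = 0) (h : N < m + n) : symb N (f * g) = 0 := by
  rw [symb_mul]
  refine Finset.sum_eq_zero ?_
  rintro ⟨p, q⟩ hx
  have hx := Finset.HasAntidiagonal.mem_antidiagonal.1 hx
  simp only at hx ⊢
  rcases lt_or_ge p m with hp | hp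
  · rw [hf p hp, zero_comp, zero_mul]
  · rw [hg q (by omega), mul_zero]

theorem symb_mul_add {m n : ℕ} {f g : ABAlgebra} (hf : ∀ i < m, symb i f = 0)
    (hg : ∀ i < n, symb i g = 0) :
    symb (m + n) (f * g) = (symb m f).comp (X + C (n : ℂ)) * symb n g := by
  rw [symb_mul, Finset.sum_eq_single (m, n)]
  · rintro ⟨p, q⟩ hx hne
    have hx := Finset.HasAntidiagonal.mem_antidiagonal.1 hx
    simp only [ne_eq, Prod.mk.injEq] at hx hne ⊢
    rcases lt_or_ge p m with hp | hp
    · rw [hf p hp, zero_comp, zero_mul]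
    · rw [hg q (by omega), mul_zero]
  · intro hx
    exact absurd (Finset.HasAntidiagonal.mem_antidiagonal.2 (by rfl)) hx

theorem symb_homPart (m : ℕ) (n : ℤ) (x : ABAlgebra) :
    symb m (homPart n x) = if (m : ℤ) = n then symb m x else 0 := by
  unfold homPart
  split_ifs with h0 h h
  · subst h
    simp only [symb_sum, symb_smul, symb_b_pow_mul_a_pow, Int.toNat_natCast]
    rw [symb]
    refine Finset.sum_congr rfl fun p hp => ?_
    rw [if_pos (Finset.HasAntidiagonal.mem_antidiagonal.1 hp).symm]
  · simp only [symb_sum, symb_smul, symb_b_pow_mul_a_pow]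
    refine Finset.sum_eq_zero fun p hp => ?_
    have := Finset.HasAntidiagonal.mem_antidiagonal.1 hp
    rw [if_neg (by omega), smul_zero]
  · omega
  · simp

/-! ### Monic homogeneous elements -/

/-- Applied to the symbols of `a^j b^(k-j)`, this recovers expansions with `a` on the left from a
symbol defined by expansions with `b` on the left. -/
theorem exists_eq_sum_of_monic {q : ℕ → ℂ[X]} (hq : ∀ j, (q j).Monic)
    (hdeg : ∀ j, (q j).natDegree = j) (k : ℕ) (p : ℂ[X]) (hp : p.degree < (k + 1 : ℕ)) :
    ∃ c : ℕ → ℂ, c k = p.coeff k ∧ p = ∑ j ∈ Finset.range (k + 1), c j • q j := by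
  induction k generalizing p with
  | zero =>
    refine ⟨fun _ => p.coeff 0, rfl, ?_⟩
    have h0 : q 0 = 1 := (hq 0).natDegree_eq_zero.1 (hdeg 0)
    have : p = C (p.coeff 0) := eq_C_of_degree_le_zero (by
      rw [degree_le_iff_coeff_zero]
      intro m hm
      exact coeff_eq_zero_of_degree_lt (hp.trans_le (by exact_mod_cast hm)))
    simp [h0, smul_eq_C_mul, ← this]
  | succ k ih =>
    obtain ⟨c, _, hc⟩ := ih (p - p.coeff (k + 1) • q (k + 1)) (by
      rw [degree_lt_iff_coeff_zero]
      intro m hm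
      rw [coeff_sub, coeff_smul, smul_eq_mul]
      rcases hm.eq_or_lt with rfl | hm
      · have := (hq (k + 1)).coeff_natDegree
        rw [hdeg] at this
        rw [this, mul_one, sub_self]
      · rw [coeff_eq_zero_of_degree_lt (hp.trans_le (by exact_mod_cast hm)),
          coeff_eq_zero_of_natDegree_lt (p := q (k + 1)) (by rw [hdeg]; exact hm)]
        simp)
    refine ⟨fun j => if j = k + 1 then p.coeff (k + 1) else c j, by simp, ?_⟩
    rw [Finset.sum_range_succ]
    simp only [if_true]
    rw [← sub_eq_iff_eq_add, hc]
    refine Finset.sum_congr rfl fun j hj => ?_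
    have := Finset.mem_range.1 hj
    rw [if_neg (by omega)]

theorem symb_a_pow_mul_b_pow (m i j : ℕ) : symb m (a ^ i * b ^ j)
    = if m = i + j then (ascPochhammer ℂ i).comp (X + C (j : ℂ)) else 0 := by
  split_ifs with h
  · subst h
    rw [symb_mul_add]
    · simp [symb_a_pow, symb_b_pow]
    · intro l hl
      rw [symb_a_pow, if_neg hl.ne]
    · intro l hl
      rw [symb_b_pow, if_neg hl.ne]
  · rw [symb_mul]
    refine Finset.sum_eq_zero ?_
    rintro ⟨p, q⟩ hx
    have hx := Finset.HasAntidiagonal.mem_antidiagonal.1 hx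
    simp only at hx ⊢
    rw [symb_a_pow, symb_b_pow]
    split_ifs <;> first | omega | simp

theorem isMonicHomogeneous_iff {k : ℕ} {x : ABAlgebra} : IsMonicHomogeneous k x ↔
    (∀ m, m ≠ k → symb m x = 0) ∧ (symb k x).coeff k = 1 := by
  have hmon : ∀ i j : ℕ, ((ascPochhammer ℂ i).comp (X + C (j : ℂ))).Monic := fun i j =>
    (monic_ascPochhammer ℂ i).comp (monic_X_add_C _) (by rw [natDegree_X_add_C]; exact one_ne_zero)
  have hdeg : ∀ i j : ℕ, ((ascPochhammer ℂ i).comp (X + C (j : ℂ))).natDegree = i := fun i j => by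
    rw [natDegree_comp, natDegree_X_add_C, ascPochhammer_natDegree, mul_one]
  constructor
  · rintro ⟨c, hc, rfl⟩
    refine ⟨fun m hm => ?_, ?_⟩
    · rw [symb_sum]
      refine Finset.sum_eq_zero fun j hj => ?_
      have := Finset.mem_range.1 hj
      rw [symb_smul, symb_a_pow_mul_b_pow, if_neg (by omega), smul_zero]
    · rw [symb_sum, finsetSum_coeff, Finset.sum_range_succ, Finset.sum_eq_zero]
      · have := (hmon k 0).coeff_natDegree
        rw [hdeg] at this
        simpa [symb_a_pow, hc] using this
      · intro j hj
        have := Finset.mem_range.1 hj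
        rw [symb_smul, symb_a_pow_mul_b_pow, if_pos (by omega), coeff_smul,
          coeff_eq_zero_of_natDegree_lt (by rw [hdeg]; exact this), smul_zero]
  · rintro ⟨h0, h1⟩
    obtain ⟨c, hc, hs⟩ := exists_eq_sum_of_monic
      (q := fun j => (ascPochhammer ℂ j).comp (X + C ((k - j : ℕ) : ℂ))) (fun j => hmon _ _)
      (fun j => hdeg _ _) k (symb k x) (degree_symb_lt k x)
    refine ⟨c, hc.trans h1, ext_symb fun m => ?_⟩
    rw [symb_sum]
    by_cases hm : m = k
    · subst hm
      rw [hs]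
      refine Finset.sum_congr rfl fun j hj => ?_
      have := Finset.mem_range.1 hj
      rw [symb_smul, symb_a_pow_mul_b_pow, if_pos (by omega)]
    · rw [h0 m hm, Finset.sum_eq_zero]
      intro j hj
      have := Finset.mem_range.1 hj
      rw [symb_smul, symb_a_pow_mul_b_pow, if_neg (by omega), smul_zero]

/-! ### Division -/

theorem IsPolyDegreeLT.add {d : ℕ} {f g : ABAlgebra} (hf : IsPolyDegreeLT d f)
    (hg : IsPolyDegreeLT d g) : IsPolyDegreeLT d (f + g) := by
  rw [isPolyDegreeLT_iff_cf] at *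
  intro ν i hi
  simp only [cf, coeffB_add, coeff_add] at *
  rw [hf ν i hi, hg ν i hi, add_zero]

theorem IsPolyDegreeLT.smul {d : ℕ} {f : ABAlgebra} (hf : IsPolyDegreeLT d f) (c : ℂ) :
    IsPolyDegreeLT d (c • f) := by
  rw [isPolyDegreeLT_iff_cf] at *
  intro ν i hi
  simp only [cf, coeffB_smul, coeff_smul] at *
  rw [hf ν i hi, smul_zero]

theorem IsPolyDegreeLT.neg {d : ℕ} {f : ABAlgebra} (hf : IsPolyDegreeLT d f) :
    IsPolyDegreeLT d (-f) := by
  simpa using hf.smul (-1)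

theorem exists_division_step {z : ABAlgebra} {m : ℕ} (hz : modB z = X ^ m) (f : ABAlgebra) :
    ∃ g, f = ofPoly (modB f /ₘ X ^ m) * z + ofPoly (modB f %ₘ X ^ m) + b * g := by
  obtain ⟨g, hg⟩ := exists_eq_add_b_mul
    (f - (ofPoly (modB f /ₘ X ^ m) * z + ofPoly (modB f %ₘ X ^ m)))
  refine ⟨g, ?_⟩
  have h0 : modB (f - (ofPoly (modB f /ₘ X ^ m) * z + ofPoly (modB f %ₘ X ^ m))) = 0 := by
    have := modByMonic_add_div (modB f) (X ^ m)
    simp only [map_sub, map_add, map_mul, modB_ofPoly, hz]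
    nth_rewrite 1 [← this]
    ring
  rw [h0, map_zero, zero_add, sub_eq_iff_eq_add'] at hg
  exact hg

/-- Division with remainder by an element which is `a^m` modulo `b`. -/
theorem exists_division {z : ABAlgebra} {m : ℕ} (hz : modB z = X ^ m) (f : ABAlgebra) :
    ∃ q r, IsPolyDegreeLT m r ∧ f = q * z + r := by
  choose T hT using exists_division_step hz
  -- Quotient and remainder are built one `b`-adic digit at a time: divide modulo `b`, replace `f`
  -- by the cofactor `T f` of `b` in the error, and repeat. The powers of `b` accumulate on the
  -- left, so they do not interfere with `z`.
  let Q : ABAlgebra → ABAlgebra := fun f => ofPS (PowerSeries.mk fun n => modB (T^[n] f) /ₘ X ^ m)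
  let R : ABAlgebra → ABAlgebra := fun f => ofPS (PowerSeries.mk fun n => modB (T^[n] f) %ₘ X ^ m)
  have hQ : ∀ f, Q f = ofPoly (modB f /ₘ X ^ m) + b * Q (T f) := by
    refine fun f => ext_coeffB fun ν => ?_
    rcases ν with _ | ν
    · rw [coeffB_add, coeffB_mk, coeffB_ofPoly, ← pow_one b, coeffB_b_pow_mul]
      simp
    · rw [coeffB_add, coeffB_mk, coeffB_ofPoly, coeffB_succ_b_mul, coeffB_mk]
      simp
  have hR : ∀ f, R f = ofPoly (modB f %ₘ X ^ m) + b * R (T f) := by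
    refine fun f => ext_coeffB fun ν => ?_
    rcases ν with _ | ν
    · rw [coeffB_add, coeffB_mk, coeffB_ofPoly, ← pow_one b, coeffB_b_pow_mul]
      simp
    · rw [coeffB_add, coeffB_mk, coeffB_ofPoly, coeffB_succ_b_mul, coeffB_mk]
      simp
  refine ⟨Q f, R f, ?_, ?_⟩
  · rw [isPolyDegreeLT_iff_cf]
    intro ν i hi
    rw [cf, coeffB_mk]
    refine coeff_eq_zero_of_degree_lt ((degree_modByMonic_lt _ (monic_X_pow m)).trans_le ?_)
    rw [degree_X_pow]
    exact_mod_cast hi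
  · have key : ∀ n, ∀ f, ∃ g, f - (Q f * z + R f) = b ^ n * g := by
      intro n
      induction n with
      | zero => exact fun f => ⟨f - (Q f * z + R f), by simp⟩
      | succ n ih =>
        intro f
        obtain ⟨g, hg⟩ := ih (T f)
        refine ⟨g, ?_⟩
        rw [pow_succ', mul_assoc, ← hg, hQ f, hR f]
        nth_rewrite 1 [hT f]
        noncomm_ring
    exact sub_eq_zero.1 (eq_zero_of_forall_dvd fun n => key n f)

theorem a_mul_b_pow (j : ℕ) : a * b ^ j = b ^ j * a + (j : ℂ) • b ^ (j + 1) := by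
  refine ext_symb fun n => ?_
  have := symb_a_pow_mul_b_pow n 1 j
  rw [pow_one] at this
  rw [this, symb_add, symb_smul, symb_b_pow]
  have h2 := symb_b_pow_mul_a_pow n j 1
  rw [pow_one] at h2
  rw [h2, add_comm j 1]
  split_ifs <;> simp [smul_eq_C_mul]

theorem ofSeries_mul_b_pow (S : PowerSeries ℂ) (n : ℕ) : ofSeries S * b ^ n = b ^ n * ofSeries S := by
  rw [b_pow_eq_ofSeries, ← map_mul, ← map_mul, mul_comm]

theorem exists_mul_b_eq (f : ABAlgebra) : ∃ g, f * b = b * g := by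
  obtain ⟨g, hg⟩ := exists_eq_add_b_mul (f * b)
  exact ⟨g, by simpa using hg⟩

end ABAlgebra

/-! ### Modules -/

section Modules

open ABAlgebra

universe u

variable {E : Type u} [AddCommGroup E] [Module ABAlgebra E]

theorem IsABModule.eq_zero_of_b_smul (hE : IsABModule E) {y : E} (h : ABAlgebra.b • y = 0) :
    y = 0 := by
  let _ := bModule E
  have : Module.Free (PowerSeries ℂ) E := hE.1
  rw [b_eq_ofSeries] at h
  have h' : (PowerSeries.X : PowerSeries ℂ) • y = 0 := h
  exact (smul_eq_zero.1 h').resolve_left PowerSeries.X_ne_zero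

/-- In a module with a simple pole, every element is killed by an element of `Ã` which is
`a^N` modulo `b` and has `(a, b)`-valuation `≥ N`. -/
theorem HasSimplePole.exists_annihilator (hs : HasSimplePole E) (hE : IsABModule E) (y : E) :
    ∃ (N : ℕ) (Q : ABAlgebra), modB Q = X ^ N ∧ (∀ i < N, symb i Q = 0) ∧ Q • y = 0 := by
  let _ := bModule E
  have : Module.Finite (PowerSeries ℂ) E := hE.2
  choose D hD using hs
  let Y : ℕ → E := fun j => D^[j] y
  have hY : ∀ j, ABAlgebra.a • Y j = ABAlgebra.b • Y (j + 1) := fun j => by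
    simp only [Y, Function.iterate_succ_apply', hD]
  -- Because `(a - j b) b^j = b^j a`, the product `(a - (j-1) b) ... (a - b) a` acts on `y` as `b^j
  -- (b⁻¹a)^j`.
  let q : ℕ → ABAlgebra := fun j => Nat.rec 1 (fun j g => (a - (j : ℂ) • b) * g) j
  have hq0 : q 0 = 1 := rfl
  have hqs : ∀ j, q (j + 1) = (a - (j : ℂ) • b) * q j := fun j => rfl
  have hqy : ∀ j, q j • y = ABAlgebra.b ^ j • Y j := by
    intro j
    induction j with
    | zero => simp [hq0, Y]
    | succ j ih =>
      have h1 : (a - (j : ℂ) • b) * b ^ j = b ^ j * a := by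
        rw [sub_mul, a_mul_b_pow, smul_mul_assoc, ← pow_succ', add_sub_cancel_right]
      rw [hqs, mul_smul, ih, ← mul_smul, h1, mul_smul, hY, ← mul_smul, ← pow_succ]
  have hqb : ∀ j, modB (q j) = X ^ j := by
    intro j
    induction j with
    | zero => simp [hq0]
    | succ j ih => rw [hqs, map_mul, ih, map_sub, modB_smul]; simp [pow_succ']
  have hqv : ∀ j, ∀ i < j, symb i (q j) = 0 := by
    intro j
    induction j with
    | zero => simp
    | succ j ih =>
      intro i hi
      rw [hqs]
      refine symb_mul_of_lt (m := 1) (n := j) (fun l hl => ?_) ih (by omega)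
      rw [symb_sub, symb_smul, symb_a, symb_b, if_neg (by omega), if_neg (by omega)]
      simp
  -- Since `ℂ[[b]]` is noetherian, the spans of the iterates stabilise, so some iterate `Y N` is a
  -- combination of the earlier ones.
  let S : ℕ →o Submodule (PowerSeries ℂ) E :=
    ⟨fun n => Submodule.span (PowerSeries ℂ) (Y '' Set.Iio n), fun n m h =>
      Submodule.span_mono (Set.image_mono (Set.Iio_subset_Iio h))⟩
  obtain ⟨N, hN⟩ := monotone_stabilizes_iff_noetherian.2
    (isNoetherian_of_isNoetherianRing_of_finite (PowerSeries ℂ) E) S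
  have hmem : Y N ∈ Submodule.span (PowerSeries ℂ) (Y '' (Finset.range N : Set ℕ)) := by
    have : Y N ∈ S (N + 1) := Submodule.subset_span ⟨N, by simp, rfl⟩
    rw [← hN (N + 1) (by omega)] at this
    rw [Finset.coe_range]
    exact this
  obtain ⟨T', hT⟩ := (Submodule.mem_span_image_finset_iff_exists_fun _).1 hmem
  let T : ℕ → PowerSeries ℂ := fun j => if h : j ∈ Finset.range N then T' ⟨j, h⟩ else 0
  have hT' : ∑ j ∈ Finset.range N, ofSeries (T j) • Y j = Y N := by
    rw [← hT, ← Finset.sum_coe_sort]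
    refine Finset.sum_congr rfl fun j _ => ?_
    simp only [T, j.2, dite_true]
    rfl
  -- This is the relation for `Y N` multiplied by `b^N`, with `b^j Y j` rewritten as `q j • y`. The
  -- correction terms vanish modulo `b` because `j < N`, and have valuation at least `(N - j) + j`.
  refine ⟨N, q N - ∑ j ∈ Finset.range N, b ^ (N - j) * (ofSeries (T j) * q j), ?_, ?_, ?_⟩
  · rw [map_sub, hqb, map_sum, Finset.sum_eq_zero, sub_zero]
    intro j hj
    have := Finset.mem_range.1 hj
    rw [map_mul, map_pow, modB_b, zero_pow (by omega), zero_mul]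
  · intro i hi
    rw [symb_sub, hqv N i hi, symb_sum, Finset.sum_eq_zero, sub_zero]
    intro j hj
    have := Finset.mem_range.1 hj
    refine symb_mul_of_lt (m := N - j) (n := j) (fun l hl => ?_) (fun l hl => ?_) (by omega)
    · rw [symb_b_pow, if_neg hl.ne]
    · exact symb_mul_of_lt (m := 0) (n := j) (by simp) (hqv j) (by omega)
  · rw [sub_smul, hqy, Finset.sum_smul, ← hT', Finset.smul_sum, sub_eq_zero]
    refine Finset.sum_congr rfl fun j hj => ?_
    have := Finset.mem_range.1 hj
    rw [mul_smul, mul_smul, hqy, ← mul_smul (ofSeries (T j)), ofSeries_mul_b_pow, mul_smul,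
      ← mul_smul (b ^ (N - j)), ← pow_add, Nat.sub_add_cancel this.le]

/-- If `a^N e ∈ bE` and `m` is minimal with `a^m e ∈ bE`, then no non-zero polynomial `p` of degree
`< m` satisfies `p(a) e ∈ bE`. -/
theorem eq_zero_of_ofPoly_smul {e : E} {N m : ℕ} (hN : ∃ y : E, a ^ N • e = ABAlgebra.b • y)
    (hm : ∀ i < m, ¬ ∃ y : E, a ^ i • e = ABAlgebra.b • y) {p : ℂ[X]} (hp : p.degree < m)
    (h : ∃ y : E, ofPoly p • e = ABAlgebra.b • y) : p = 0 := by
  by_contra h0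
  obtain ⟨g, hg, hdvd⟩ := exists_eq_pow_rootMultiplicity_mul_and_not_dvd p h0 0
  rw [C_0, sub_zero] at hg hdvd
  set i := p.rootMultiplicity 0
  have hg0 : g ≠ 0 := by
    rintro rfl
    simp at hdvd
  have hi : i < m := by
    have hle : i ≤ p.natDegree := by
      rw [hg, natDegree_X_pow_mul i hg0]
      omega
    rw [degree_eq_natDegree h0] at hp
    exact hle.trans_lt (by exact_mod_cast hp)
  -- With `p = X^i g` and `g(0) ≠ 0`, a Bézout relation writes `X^i` as a combination of `X^N` and
  -- `p`, both of which send `e` into `bE`. This contradicts the minimality of `m`, as `i < m`.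
  obtain ⟨u, v, huv⟩ : IsCoprime (X ^ N) g :=
    (irreducible_X.coprime_iff_not_dvd.2 hdvd).pow_left
  refine hm i hi ?_
  obtain ⟨y, hy⟩ := h
  obtain ⟨y', hy'⟩ := hN
  have hX : (X : ℂ[X]) ^ i = (u * X ^ i) * X ^ N + v * p := by
    rw [hg]
    linear_combination (-X ^ i) * huv
  obtain ⟨w, hw⟩ := exists_mul_b_eq (ofPoly (u * X ^ i))
  obtain ⟨w', hw'⟩ := exists_mul_b_eq (ofPoly v)
  refine ⟨w • y' + w' • y, ?_⟩
  have : a ^ i = ofPoly (u * X ^ i) * a ^ N + ofPoly v * ofPoly p := by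
    rw [← ofPoly_X, ← map_pow, ← map_pow, ← map_mul, ← map_mul, ← map_add, ← hX]
  rw [this, add_smul, mul_smul, mul_smul, hy, hy', ← mul_smul, ← mul_smul, hw, hw', mul_smul,
    mul_smul, smul_add]

/-- The reduction of `r` modulo `b` vanishes by `eq_zero_of_ofPoly_smul`. As `E` has no `b`-torsion,
the factor `b` can be removed and the argument repeated, so `r` is divisible by every power of `b`.
-/
theorem IsABModule.eq_zero_of_smul_eq_zero (hE : IsABModule E) {e : E} {N m : ℕ}
    (hN : ∃ y : E, a ^ N • e = ABAlgebra.b • y)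
    (hm : ∀ i < m, ¬ ∃ y : E, a ^ i • e = ABAlgebra.b • y) {r : ABAlgebra}
    (hr : IsPolyDegreeLT m r) (h : r • e = 0) : r = 0 := by
  refine eq_zero_of_forall_dvd fun n => ?_
  suffices ∃ g, r = b ^ n * g ∧ IsPolyDegreeLT m g ∧ g • e = 0 from
    let ⟨g, hg, _⟩ := this; ⟨g, hg⟩
  induction n with
  | zero => exact ⟨r, by simp, hr, h⟩
  | succ n ih =>
    obtain ⟨g, hg, hgm, hge⟩ := ih
    obtain ⟨g', hg'⟩ := exists_eq_add_b_mul g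
    have hgm' := isPolyDegreeLT_iff_cf.1 hgm
    have h0 : modB g = 0 := by
      refine eq_zero_of_ofPoly_smul hN hm ?_ (e := e) ⟨-(g' • e), ?_⟩
      · exact (degree_lt_iff_coeff_zero _ _).2 fun i hi => hgm' 0 i hi
      · rw [smul_neg, ← mul_smul, eq_neg_iff_add_eq_zero, ← add_smul, ← hg', hge]
    rw [h0, map_zero, zero_add] at hg'
    refine ⟨g', ?_, ?_, ?_⟩
    · rw [hg, hg', ← mul_assoc, ← pow_succ]
    · rw [isPolyDegreeLT_iff_cf]
      intro ν i hi
      rw [cf, ← coeffB_succ_b_mul, ← hg']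
      exact hgm' _ i hi
    · refine hE.eq_zero_of_b_smul ?_
      rw [← mul_smul, ← hg', hge]

theorem abRank_eq_of_basis {e : E} {m : ℕ}
    (hspan : ∀ y : E, ∃ r, IsPolyDegreeLT m r ∧ r • e = y)
    (hindep : ∀ r, IsPolyDegreeLT m r → r • e = 0 → r = 0) : abRank E = m := by
  let _ := bModule E
  let v : Fin m → E := fun j => a ^ (j : ℕ) • e
  have hsmul : ∀ S : ℕ → PowerSeries ℂ, ∑ j : Fin m, S j • v j
      = (∑ j ∈ Finset.range m, ofSeries (S j) * a ^ j) • e := by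
    intro S
    rw [Finset.sum_smul, ← Fin.sum_univ_eq_sum_range fun j => (ofSeries (S j) * a ^ j) • e]
    refine Finset.sum_congr rfl fun j _ => ?_
    rw [mul_smul]
    rfl
  have hli : LinearIndependent (PowerSeries ℂ) v := by
    rw [Fintype.linearIndependent_iff]
    intro g hg j
    let S : ℕ → PowerSeries ℂ := fun i => if h : i < m then g ⟨i, h⟩ else 0
    have hS : ∀ j : Fin m, g j = S j := fun j => by simp [S]
    simp only [hS] at hg
    rw [hsmul] at hg
    have h0 := hindep _ ⟨S, rfl⟩ hg
    ext ν
    have h1 := congrArg (cf ν j) h0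
    rw [cf, coeffB_sum, finsetSum_coeff, Finset.sum_eq_single (j : ℕ)] at h1
    · rw [coeffB_mul_a_pow, coeffB_ofSeries] at h1
      rw [hS]
      simpa [cf] using h1
    · intro i _ hij
      rw [coeffB_mul_a_pow, coeffB_ofSeries, coeff_C_mul_X_pow, if_neg hij.symm]
    · intro hj
      exact absurd (Finset.mem_range.2 j.2) hj
  have hsp : ⊤ ≤ Submodule.span (PowerSeries ℂ) (Set.range v) := by
    intro y _
    obtain ⟨r, ⟨S, rfl⟩, rfl⟩ := hspan y
    rw [← hsmul]
    exact Submodule.sum_mem _ fun j _ => Submodule.smul_mem _ _ (Submodule.subset_span ⟨j, rfl⟩)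
  have := Module.finrank_eq_card_basis (Module.Basis.mk hli hsp)
  rw [Fintype.card_fin] at this
  exact this

/-- Lowest symbols multiply without cancellation in the domain `ℂ[X]`, so valuations add. Modulo
`b`, `w` is `a^(N-m)`, hence its valuation is at most `N - m`; since that of `Q` is at least `N`,
that of `x` is at least `m`. -/
theorem ABAlgebra.symb_eq_zero_of_mul {w x Q : ABAlgebra} {m N : ℕ} (hx : modB x = X ^ m)
    (hQ : modB Q = X ^ N) (hQv : ∀ i < N, symb i Q = 0) (h : Q = w * x) :
    ∀ i < m, symb i x = 0 := by
  have hmod : (X : ℂ[X]) ^ N = modB w * X ^ m := by rw [← hQ, h, map_mul, hx]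
  have hmN : m ≤ N := by
    have := (pow_dvd_pow_iff (X_ne_zero (R := ℂ)) not_isUnit_X).1 (Dvd.intro_left _ hmod.symm)
    exact this
  have hw : modB w = X ^ (N - m) := by
    refine mul_right_cancel₀ (pow_ne_zero m (X_ne_zero (R := ℂ))) ?_
    rw [← hmod, ← pow_add, Nat.sub_add_cancel hmN]
  classical
  have hwN : symb (N - m) w ≠ 0 := fun h0 => by
    have h1 : cf 0 (N - m) w = 0 := symb_eq_zero_iff.1 h0 0 (N - m) (by omega)
    rw [cf, ← modB_apply, hw] at h1
    simp at h1
  have hex : ∃ t, symb t w ≠ 0 := ⟨_, hwN⟩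
  by_contra! hcon
  obtain ⟨i, him, hi⟩ := hcon
  have hex' : ∃ s, symb s x ≠ 0 := ⟨i, hi⟩
  have h1 := symb_mul_add (f := w) (g := x) (m := Nat.find hex) (n := Nat.find hex')
    (fun l hl => not_not.1 (Nat.find_min hex hl)) (fun l hl => not_not.1 (Nat.find_min hex' hl))
  have h2 : Nat.find hex ≤ N - m := Nat.find_min' hex hwN
  have h3 : Nat.find hex' ≤ i := Nat.find_min' hex' hi
  rw [← h, hQv _ (by omega)] at h1
  rcases mul_eq_zero.1 h1.symm with h4 | h4
  · refine Nat.find_spec hex ?_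
    have h5 := congrArg (fun p => p.comp (X - C ((Nat.find hex' : ℕ) : ℂ))) h4
    simpa [comp_assoc] using h5
  · exact Nat.find_spec hex' h4

/-- A monogenic regular (a,b)-module of rank `k` is `Ã ⧸ Ã x` with `x` monic of degree `k` in `a`
and of `(a, b)`-valuation `≥ k`. -/
theorem exists_presentation (hreg : IsRegularABModule E) (hmono : IsMonogenic E) :
    ∃ y, IsPolyDegreeLT (abRank E) y ∧ (∀ i < abRank E, symb i (a ^ abRank E + y) = 0) ∧
      IsPresentedBy E (a ^ abRank E + y) := by
  classical
  obtain ⟨hE, F, _, _, hF, hs, f, hf⟩ := hreg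
  obtain ⟨I, ⟨φ⟩⟩ := hmono
  let e : E := φ.symm (Submodule.Quotient.mk 1)
  have hφ : ∀ g : ABAlgebra, φ (g • e) = Submodule.Quotient.mk g := fun g => by
    rw [map_smul, LinearEquiv.apply_symm_apply, ← Submodule.Quotient.mk_smul, smul_eq_mul, mul_one]
  have hgen : ∀ y : E, ∃ g : ABAlgebra, g • e = y := fun y => by
    obtain ⟨g, hg⟩ := Submodule.Quotient.mk_surjective I (φ y)
    exact ⟨g, φ.injective ((hφ g).trans hg)⟩
  have hI : ∀ g : ABAlgebra, g • e = 0 ↔ g ∈ I := fun g => by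
    rw [← φ.map_eq_zero_iff, hφ, Submodule.Quotient.mk_eq_zero]
  obtain ⟨N, Q, hQb, hQv, hQ⟩ := hs.exists_annihilator hF (f e)
  have hQe : Q • e = 0 := hf (by rw [map_smul, hQ, map_zero])
  have hN : ∃ y : E, a ^ N • e = ABAlgebra.b • y := by
    obtain ⟨g, hg⟩ := exists_eq_add_b_mul Q
    rw [hQb, map_pow, ofPoly_X] at hg
    refine ⟨-(g • e), ?_⟩
    rw [smul_neg, ← mul_smul, eq_neg_iff_add_eq_zero, ← add_smul, ← hg, hQe]
  have hex : ∃ m, ∃ y : E, a ^ m • e = ABAlgebra.b • y := ⟨N, hN⟩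
  obtain ⟨m, ⟨y, hy⟩, hm⟩ : ∃ m, (∃ y : E, a ^ m • e = ABAlgebra.b • y) ∧
      ∀ i < m, ¬ ∃ y : E, a ^ i • e = ABAlgebra.b • y :=
    ⟨Nat.find hex, Nat.find_spec hex, fun i hi => Nat.find_min hex hi⟩
  have hindep : ∀ r, IsPolyDegreeLT m r → r • e = 0 → r = 0 := fun r hr h =>
    hE.eq_zero_of_smul_eq_zero hN hm hr h
  obtain ⟨g, rfl⟩ := hgen y
  have hzb : modB (a ^ m - b * g) = X ^ m := by simp
  have hze : (a ^ m - b * g) • e = 0 := by rw [sub_smul, mul_smul, hy, sub_self]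
  have hspan : ∀ y : E, ∃ r, IsPolyDegreeLT m r ∧ r • e = y := by
    intro y
    obtain ⟨h, rfl⟩ := hgen y
    obtain ⟨q, r, hr, rfl⟩ := exists_division hzb h
    exact ⟨r, hr, by rw [add_smul, mul_smul, hze, smul_zero, zero_add]⟩
  have hk : abRank E = m := abRank_eq_of_basis hspan hindep
  rw [hk]
  -- The annihilator `a^m - b g` may have unbounded degree in `a`. Dividing `a^m` by it gives an
  -- annihilator `a^m - r` that is monic of degree `m`.
  obtain ⟨q, r, hr, hqr⟩ := exists_division hzb (a ^ m)
  have hxe : (a ^ m + -r) • e = 0 := by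
    rw [← sub_eq_add_neg, sub_eq_of_eq_add hqr, mul_smul, hze, smul_zero]
  have hrb : modB r = 0 := by
    have h1 := congrArg modB hqr
    rw [map_add, map_mul, hzb, map_pow, modB_a] at h1
    ext i
    rcases lt_or_ge i m with hi | hi
    · have h2 := congrArg (fun p => p.coeff i) h1
      simpa [coeff_X_pow, coeff_mul_X_pow', hi.ne, not_le.2 hi] using h2.symm
    · exact isPolyDegreeLT_iff_cf.1 hr 0 i hi
  have hxb : modB (a ^ m + -r) = X ^ m := by simp [hrb]
  have hann : ∀ h : ABAlgebra, h • e = 0 → ∃ w, h = w * (a ^ m + -r) := by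
    intro h hh
    obtain ⟨w, s, hs, rfl⟩ := exists_division hxb h
    rw [add_smul, mul_smul, hxe, smul_zero, zero_add] at hh
    exact ⟨w, by rw [hindep s hs hh, add_zero]⟩
  refine ⟨-r, hr.neg, ?_, ?_⟩
  -- The valuation bound comes from regularity: the annihilator `Q` obtained in the simple pole
  -- module is a left multiple of `x`.
  · obtain ⟨w, hw⟩ := hann Q hQe
    exact symb_eq_zero_of_mul hxb hQb hQv hw
  · have hIx : I = Submodule.span ABAlgebra {a ^ m + -r} := by
      ext h
      rw [← hI, Submodule.mem_span_singleton]
      constructor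
      · intro hh
        obtain ⟨w, hw⟩ := hann h hh
        exact ⟨w, hw.symm⟩
      · rintro ⟨w, rfl⟩
        rw [smul_eq_mul, mul_smul, hxe, smul_zero]
    rw [hIx] at φ
    exact ⟨φ⟩

end Modules

/-! ### Commutators with linear elements, and divisibility by powers of `b` -/

namespace ABAlgebra

theorem degree_comp_X_add_C_lt {p : ℂ[X]} {d : ℕ} (hp : p.degree < d) (c : ℂ) :
    (p.comp (X + C c)).degree < d := by
  rw [← taylor_apply, degree_taylor]
  exact hp

theorem coeff_comp_X_add_C_one {p : ℂ[X]} {k : ℕ} (hp : p.degree < (k + 1 : ℕ)) (m : ℕ) :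
    (p.comp (X + C 1)).coeff m = ∑ i ∈ Finset.range (k + 1), p.coeff i * (i.choose m : ℂ) := by
  have h : p.natDegree < k + 1 := by
    rcases eq_or_ne p 0 with rfl | h0
    · simp
    · exact (natDegree_lt_iff_degree_lt h0).2 hp
  conv_lhs => rw [p.as_sum_range' (k + 1) h]
  simp only [Polynomial.sum_comp, monomial_comp, finsetSum_coeff, coeff_C_mul, C_1, coeff_X_add_one_pow]

theorem coeff_comp_X_add_C_one_sub {p : ℂ[X]} {k : ℕ} (hp : p.degree < (k + 1 : ℕ)) {m : ℕ}
    (hm : k ≤ m) : (p.comp (X + C 1) - p).coeff m = 0 := by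
  rw [coeff_sub, coeff_comp_X_add_C_one hp, Finset.sum_range_succ, Finset.sum_eq_zero]
  · rcases hm.eq_or_lt with rfl | hm
    · simp
    · rw [Nat.choose_eq_zero_of_lt hm, coeff_eq_zero_of_degree_lt (n := m)
        (hp.trans_le (by exact_mod_cast hm))]
      simp
  · intro i hi
    rw [Nat.choose_eq_zero_of_lt (by have := Finset.mem_range.1 hi; omega)]
    simp

theorem coeff_comp_X_add_C_one_sub_pred {p : ℂ[X]} {j : ℕ} (hp : p.degree < (j + 1 + 1 : ℕ))
    (h1 : p.coeff (j + 1) = 1) : (p.comp (X + C 1) - p).coeff j = (j + 1 : ℕ) := by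
  rw [coeff_sub, coeff_comp_X_add_C_one hp, Finset.sum_range_succ, Finset.sum_range_succ,
    Finset.sum_eq_zero]
  · simp [h1]
  · intro i hi
    rw [Nat.choose_eq_zero_of_lt (Finset.mem_range.1 hi)]
    simp

/-- The symbol of the commutator of a homogeneous element with symbol `p` and degree `k`
with `α a + β b`. -/
def commSymb (p : ℂ[X]) (k : ℕ) (α β : ℂ) : ℂ[X] :=
  p.comp (X + C 1) * (C α * X + C β) - (C α * (X + C (k : ℂ)) + C β) * p

theorem commSymb_eq (p : ℂ[X]) (k : ℕ) (α β : ℂ) : commSymb p k α β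
    = C α * ((p.comp (X + C 1) - p) * X) + C β * (p.comp (X + C 1) - p) - C (α * k) * p := by
  rw [commSymb, C_mul]
  ring

theorem commSymb_mul (p : ℂ[X]) (k : ℕ) (t α β : ℂ) :
    commSymb p k (t * α) (t * β) = t • commSymb p k α β := by
  simp only [commSymb, smul_eq_C_mul, C_mul]
  ring

/-- The difference `p(X+1) - p` has leading term `k X^(k-1)`. Multiplied by `α X` it contributes `α
k` at `X^k`, which `-α k p` cancels. -/
theorem coeff_commSymb_of_le {p : ℂ[X]} {k : ℕ} (hp : p.degree < (k + 1 : ℕ))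
    (h1 : p.coeff k = 1) (α β : ℂ) {m : ℕ} (hm : k ≤ m) : (commSymb p k α β).coeff m = 0 := by
  rw [commSymb_eq, coeff_sub, coeff_add, coeff_C_mul, coeff_C_mul, coeff_C_mul,
    coeff_comp_X_add_C_one_sub hp hm]
  rcases m with _ | m
  · obtain rfl : k = 0 := by omega
    simp
  · rw [coeff_mul_X]
    rcases hm.eq_or_lt with rfl | hm
    · rw [coeff_comp_X_add_C_one_sub_pred hp h1, h1]
      ring
    · rw [coeff_comp_X_add_C_one_sub hp (by omega), coeff_eq_zero_of_degree_lt (n := m + 1)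
        (hp.trans_le (by exact_mod_cast hm))]
      ring

/-- The point is the non-zero factor `j + 1` at `β`: the equation has a solution with `α = 1`, its
solutions form a line, and none but zero has `α = 0`. -/
theorem exists_coeff_commSymb_pred {p : ℂ[X]} {j : ℕ} (hp : p.degree < (j + 1 + 1 : ℕ))
    (h1 : p.coeff (j + 1) = 1) : ∃ l : ℂ, ∀ α β,
      (commSymb p (j + 1) α β).coeff j = α * l + β * (j + 1 : ℕ) := by
  refine ⟨((p.comp (X + C 1) - p) * X).coeff j - (j + 1 : ℕ) * p.coeff j, fun α β => ?_⟩
  rw [commSymb_eq, coeff_sub, coeff_add, coeff_C_mul, coeff_C_mul, coeff_C_mul,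
    coeff_comp_X_add_C_one_sub_pred hp h1]
  ring

theorem degree_commSymb_lt_iff {p : ℂ[X]} {j : ℕ} (hp : p.degree < (j + 1 + 1 : ℕ))
    (h1 : p.coeff (j + 1) = 1) (α β : ℂ) :
    (commSymb p (j + 1) α β).degree < j ↔ (commSymb p (j + 1) α β).coeff j = 0 := by
  rw [degree_lt_iff_coeff_zero]
  refine ⟨fun h => h j le_rfl, fun h m hm => ?_⟩
  rcases hm.eq_or_lt with rfl | hm
  · exact h
  · exact coeff_commSymb_of_le hp h1 α β hm

theorem symb_mul_of_homogeneous {m n N : ℕ} {f g : ABAlgebra} (hf : ∀ i, i ≠ m → symb i f = 0)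
    (hg : ∀ i, i ≠ n → symb i g = 0) (h : N ≠ m + n) : symb N (f * g) = 0 := by
  rw [symb_mul]
  refine Finset.sum_eq_zero ?_
  rintro ⟨p, q⟩ hx
  have hx := Finset.HasAntidiagonal.mem_antidiagonal.1 hx
  simp only at hx ⊢
  by_cases hp : p = m
  · rw [hg q (by omega), mul_zero]
  · rw [hf p hp, zero_comp, zero_mul]

theorem symb_linear (n : ℕ) (α β : ℂ) :
    symb n (α • a + β • b) = if n = 1 then C α * X + C β else 0 := by
  rw [symb_add, symb_smul, symb_smul, symb_a, symb_b]
  split_ifs <;> simp [smul_eq_C_mul]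

theorem symb_lie_linear {k : ℕ} {P : ABAlgebra} (hP : ∀ m, m ≠ k → symb m P = 0) (n : ℕ)
    (α β : ℂ) : symb n ⁅P, α • a + β • b⁆
      = if n = k + 1 then commSymb (symb k P) k α β else 0 := by
  have hl : ∀ i, i ≠ 1 → symb i (α • a + β • b) = 0 := fun i hi => by rw [symb_linear, if_neg hi]
  rw [Ring.lie_def, symb_sub]
  split_ifs with h
  · subst h
    rw [symb_mul_add (fun i hi => hP i hi.ne) (fun i hi => hl i hi.ne), add_comm k 1,
      symb_mul_add (fun i hi => hl i hi.ne) (fun i hi => hP i hi.ne), symb_linear, if_pos rfl,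
      commSymb]
    simp
  · rw [symb_mul_of_homogeneous hP hl h, symb_mul_of_homogeneous hl hP (by omega), sub_zero]

theorem isPolyDegreeLT_lie_iff {k d : ℕ} {P : ABAlgebra} (hP : ∀ m, m ≠ k → symb m P = 0)
    (α β : ℂ) :
    IsPolyDegreeLT d ⁅P, α • a + β • b⁆ ↔ (commSymb (symb k P) k α β).degree < d := by
  rw [isPolyDegreeLT_iff]
  constructor
  · intro h
    have := h (k + 1)
    rwa [symb_lie_linear hP, if_pos rfl] at this
  · intro h n
    rw [symb_lie_linear hP]
    split_ifs
    · exact h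
    · rw [degree_zero]
      exact WithBot.bot_lt_coe d

theorem symb_zero_eq_C (f : ABAlgebra) : symb 0 f = C ((symb 0 f).coeff 0) :=
  eq_C_of_degree_le_zero (by
    rw [degree_le_iff_coeff_zero]
    intro m hm
    exact coeff_eq_zero_of_degree_lt ((degree_symb_lt 0 f).trans_le (by exact_mod_cast hm)))

theorem symb_b_pow_mul_eq_zero {k d : ℕ} {n : ℤ} (hn : n = (k : ℤ) + 1 - d) {R : ABAlgebra}
    (hR : HasValuationGE n R) : ∀ i < k + 1, symb i (b ^ d * R) = 0 := by
  intro i hi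
  rcases lt_or_ge i d with h | h
  · exact symb_b_pow_mul_of_lt h R
  · obtain ⟨j, rfl⟩ := Nat.exists_eq_add_of_le' h
    rw [symb_b_pow_mul_add]
    exact hasValuationGE_iff.1 hR j (by omega)

theorem IsPolyDegreeLT.b_pow_mul {k d : ℕ} {R : ABAlgebra} (hR : IsPolyDegreeLT k R) :
    IsPolyDegreeLT k (b ^ d * R) := by
  rw [isPolyDegreeLT_iff_cf] at *
  intro ν i hi
  rw [cf, coeffB_b_pow_mul]
  split_ifs
  · exact hR _ i hi
  · simp

/-- Valuation above `k` and degree below `k` in `a` already force two factors `b`. So `hd` is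
vacuous for `d = 2`, and for `d = 3` it only excludes the monomial `b² a^(k-1)`. -/
theorem exists_eq_b_pow_mul_of {k d : ℕ} {n : ℤ} (hn : n = (k : ℤ) + 1 - d) {y : ABAlgebra}
    (hy : IsPolyDegreeLT k y) (hv : ∀ i < k + 1, symb i y = 0)
    (hd : ∀ ν < d, ∀ i < k, k + 1 ≤ ν + i → cf ν i y = 0) :
    ∃ R, y = b ^ d * R ∧ IsPolyDegreeLT k R ∧ HasValuationGE n R := by
  have hy' := isPolyDegreeLT_iff_cf.1 hy
  obtain ⟨R, rfl⟩ := exists_eq_b_pow_mul d (f := y) fun ν hν => Polynomial.ext fun i => by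
    rcases lt_or_ge i k with hi | hi
    · rcases lt_or_ge (ν + i) (k + 1) with h | h
      · simpa using symb_eq_zero_iff.1 (hv _ h) ν i rfl
      · simpa using hd ν hν i hi h
    · simpa using hy' ν i hi
  refine ⟨R, rfl, ?_, ?_⟩
  · rw [isPolyDegreeLT_iff_cf]
    intro ν i hi
    rw [cf, ← coeffB_b_pow_mul_add d]
    exact hy' _ i hi
  · rw [hasValuationGE_iff]
    intro m hm
    rw [← symb_b_pow_mul_add m d]
    exact hv _ (by omega)

theorem IsPolyDegreeLT.ofSeries_mul {d : ℕ} {f : ABAlgebra} (hf : IsPolyDegreeLT d f)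
    (S : PowerSeries ℂ) : IsPolyDegreeLT d (ofSeries S * f) := by
  rw [isPolyDegreeLT_iff] at *
  intro n
  rw [← mem_degreeLT, symb_mul]
  refine Submodule.sum_mem _ fun x _ => ?_
  rw [symb_ofSeries, C_comp, ← smul_eq_C_mul]
  exact Submodule.smul_mem _ _ (mem_degreeLT.2 (hf _))

theorem IsPolyDegreeLT.mul_ofSeries {d : ℕ} {f : ABAlgebra} (hf : IsPolyDegreeLT d f)
    (S : PowerSeries ℂ) : IsPolyDegreeLT d (f * ofSeries S) := by
  rw [isPolyDegreeLT_iff] at *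
  intro n
  rw [← mem_degreeLT, symb_mul]
  refine Submodule.sum_mem _ fun x _ => ?_
  rw [symb_ofSeries, mul_comm, ← smul_eq_C_mul]
  exact Submodule.smul_mem _ _ (mem_degreeLT.2 (degree_comp_X_add_C_lt (hf _) _))

/-! ### Comparison of two presentations -/

theorem symb_mul_add_one {m n : ℕ} {f g : ABAlgebra} (hf : ∀ i < m, symb i f = 0)
    (hg : ∀ i < n, symb i g = 0) : symb (m + n + 1) (f * g)
      = (symb (m + 1) f).comp (X + C (n : ℂ)) * symb n g
        + (symb m f).comp (X + C ((n + 1 : ℕ) : ℂ)) * symb (n + 1) g := by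
  rw [symb_mul, Finset.sum_eq_add (m + 1, n) (m, n + 1) (by simp)]
  · rintro ⟨p, q⟩ hx hne
    have hx := Finset.HasAntidiagonal.mem_antidiagonal.1 hx
    simp only [ne_eq, Prod.mk.injEq] at hx hne ⊢
    rcases lt_or_ge p m with hp | hp
    · rw [hf p hp, zero_comp, zero_mul]
    · rw [hg q (by omega), mul_zero]
  · intro hx
    exact absurd (Finset.HasAntidiagonal.mem_antidiagonal.2 (by simp only; omega)) hx
  · intro hx
    exact absurd (Finset.HasAntidiagonal.mem_antidiagonal.2 (by simp only; omega)) hx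

/-- In degree `k` only the constant terms of `u` and `v` contribute; they are scalars, and comparing
coefficients of `X^k` makes them equal. -/
theorem symb_of_mul_eq_mul {k : ℕ} {x x' u v : ABAlgebra} (hx : ∀ i < k, symb i x = 0)
    (hx' : ∀ i < k, symb i x' = 0) (h1 : (symb k x).coeff k = 1) (h1' : (symb k x').coeff k = 1)
    (hu : symb 0 u ≠ 0) (h : x * u = v * x') : symb 0 u = symb 0 v ∧ symb k x = symb k x' := by
  have e1 := symb_mul_add (n := 0) (g := u) hx (by simp)
  have e2 := symb_mul_add (m := 0) (f := v) (by simp) hx'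
  rw [zero_add, ← h, ← add_zero k, e1, symb_zero_eq_C u, symb_zero_eq_C v, add_zero] at e2
  simp only [Nat.cast_zero, C_0, add_zero, comp_X, C_comp] at e2
  have e3 := congrArg (fun p => p.coeff k) e2
  simp only [coeff_mul_C, coeff_C_mul, h1, h1', one_mul, mul_one] at e3
  have e4 : symb 0 u = symb 0 v := by rw [symb_zero_eq_C u, symb_zero_eq_C v, e3]
  refine ⟨e4, ?_⟩
  rw [← symb_zero_eq_C, ← symb_zero_eq_C, ← e4, mul_comm] at e2
  exact mul_left_cancel₀ hu e2

theorem exists_symb_one (u : ABAlgebra) : ∃ α β : ℂ, symb 1 u = C α * X + C β := by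
  refine ⟨_, _, eq_X_add_C_of_degree_le_one ?_⟩
  rw [degree_le_iff_coeff_zero]
  intro m hm
  exact coeff_eq_zero_of_degree_lt ((degree_symb_lt 1 u).trans_le (by exact_mod_cast hm))

/-- If `x u = v x'` with `x` and `x'` of valuation `k` and equal initial forms, and if the next
homogeneous parts have degree `< k` in `a`, then these differ by a commutator. -/
theorem exists_commSymb_of_mul_eq_mul {k : ℕ} {x x' u v : ABAlgebra} (hx : ∀ i < k, symb i x = 0)
    (hx' : ∀ i < k, symb i x' = 0) (h1 : (symb k x).coeff k = 1) (h1' : (symb k x').coeff k = 1)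
    (hs : (symb (k + 1) x).degree < k) (hs' : (symb (k + 1) x').degree < k)
    (hu : symb 0 u ≠ 0) (h : x * u = v * x') :
    ∃ α β : ℂ, symb (k + 1) x - symb (k + 1) x' = commSymb (symb k x) k α β := by
  obtain ⟨huv, hxx⟩ := symb_of_mul_eq_mul hx hx' h1 h1' hu h
  have e1 := symb_mul_add_one (n := 0) (g := u) hx (by simp)
  have e2 := symb_mul_add_one (m := 0) (f := v) (by simp) hx'
  obtain ⟨α, β, hu1⟩ := exists_symb_one u
  obtain ⟨α', β', hv1⟩ := exists_symb_one v
  rw [add_zero, zero_add, hu1] at e1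
  rw [zero_add, zero_add, ← h, e1, hv1, ← huv, ← hxx, symb_zero_eq_C u] at e2
  rw [symb_zero_eq_C] at hu
  set c := (symb 0 u).coeff 0
  set p := symb k x
  have hc : c ≠ 0 := by simpa using hu
  have hp : p.degree < (k + 1 : ℕ) := degree_symb_lt k x
  simp only [Nat.cast_zero, C_0, add_zero, comp_X, C_comp, add_comp, mul_comp, X_comp, Nat.cast_one] at e2
  have e3 : C c * (symb (k + 1) x - symb (k + 1) x') + commSymb p k α β
      = (C (α' - α) * (X + C (k : ℂ)) + C (β' - β)) * p := by
    rw [commSymb, C_sub, C_sub]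
    linear_combination e2
  -- By `e3` this product has degree below `k`, whereas `p` has degree exactly `k`; hence the linear
  -- factor, which measures the difference of the linear parts of `v` and `u`, is zero.
  have hk : ∀ m, k ≤ m → ((C (α' - α) * (X + C (k : ℂ)) + C (β' - β)) * p).coeff m = 0 := by
    intro m hm
    rw [← e3, coeff_add, coeff_commSymb_of_le hp h1 α β hm, coeff_C_mul, coeff_sub,
      (degree_lt_iff_coeff_zero _ _).1 hs m hm, (degree_lt_iff_coeff_zero _ _).1 hs' m hm]
    simp
  have e4 : (C (α' - α) * (X + C (k : ℂ)) + C (β' - β)) * p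
      = C (α' - α) * (p * X) + C ((α' - α) * k + (β' - β)) * p := by
    simp only [C_add, C_mul]
    ring
  have hα : α' - α = 0 := by
    have := hk (k + 1) (by omega)
    rw [e4, coeff_add, coeff_C_mul, coeff_C_mul, coeff_mul_X, h1,
      coeff_eq_zero_of_degree_lt hp] at this
    simpa using this
  have hβ : β' - β = 0 := by
    have := hk k le_rfl
    rw [e4, hα, coeff_add, coeff_C_mul, coeff_C_mul, h1] at this
    simpa using this
  rw [hα, hβ, C_0, zero_mul, zero_add, zero_mul, ← smul_eq_C_mul, add_eq_zero_iff_eq_neg] at e3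
  refine ⟨-c⁻¹ * α, -c⁻¹ * β, ?_⟩
  rw [commSymb_mul, neg_smul, ← smul_neg, ← e3, smul_smul, inv_mul_cancel₀ hc, one_smul]

theorem IsPolyDegreeLT.eq_zero {f : ABAlgebra} (h : IsPolyDegreeLT 0 f) : f = 0 := by
  obtain ⟨S, rfl⟩ := h
  simp

theorem isPolyDegreeLT_zero (d : ℕ) : IsPolyDegreeLT d 0 :=
  ⟨0, by simp⟩

theorem IsMonicHomogeneous.eq_one {P : ABAlgebra} (h : IsMonicHomogeneous 0 P) : P = 1 := by
  obtain ⟨c, hc, rfl⟩ := h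
  simp [hc]

theorem degree_symb_b_pow_three_mul_lt {k : ℕ} (S : ABAlgebra) :
    (symb (k + 1) (b ^ 3 * S)).degree < (k - 1 : ℕ) := by
  rw [degree_symb_lt_iff]
  intro ν i h hi
  rw [cf, coeffB_b_pow_mul, if_neg (by omega), coeff_zero]

theorem symb_b_pow_three_mul_homPart (k n : ℕ) (S : ABAlgebra) :
    symb n (b ^ 3 * homPart ((k : ℤ) - 2) S)
      = if n = k + 1 then symb n (b ^ 3 * S) else 0 := by
  rcases lt_or_ge n 3 with h | h
  · rw [symb_b_pow_mul_of_lt h, symb_b_pow_mul_of_lt h, ite_self]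
  · obtain ⟨m, rfl⟩ := Nat.exists_eq_add_of_le' h
    rw [symb_b_pow_mul_add, symb_b_pow_mul_add, symb_homPart]
    by_cases hm : m + 3 = k + 1
    · rw [if_pos hm, if_pos (by omega)]
    · rw [if_neg hm, if_neg (by omega)]

theorem exists_ofSeries_eq_one_add (β : ℂ) : ∃ U V : PowerSeries ℂ,
    ofSeries U = 1 + β • b ∧ ofSeries U * ofSeries V = 1 ∧ ofSeries V * ofSeries U = 1 := by
  have hU : PowerSeries.constantCoeff (1 + PowerSeries.C β * PowerSeries.X) ≠ 0 := by simp
  refine ⟨1 + PowerSeries.C β * PowerSeries.X, (1 + PowerSeries.C β * PowerSeries.X)⁻¹, ?_, ?_, ?_⟩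
  · refine ext_symb fun n => ?_
    rw [symb_ofSeries, symb_add, symb_smul, symb_one, symb_b, map_add, PowerSeries.coeff_one,
      PowerSeries.coeff_C_mul, PowerSeries.coeff_X, C_add, C_mul, smul_eq_C_mul]
    split_ifs <;> simp
  · rw [← map_mul, PowerSeries.mul_inv_cancel _ hU, map_one]
  · rw [← map_mul, PowerSeries.inv_mul_cancel _ hU, map_one]

end ABAlgebra

/-! ### Isomorphisms of presentations, and the claims about the Bernstein element -/

open ABAlgebra

section Modules

universe u

variable {E : Type u} [AddCommGroup E] [Module ABAlgebra E]

/-- An isomorphism `Ã ⧸ Ã x ≃ Ã ⧸ Ã x'` is right multiplication by some `u`. -/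
theorem IsPresentedBy.exists_mul_eq_mul {x x' : ABAlgebra} (h : IsPresentedBy E x)
    (h' : IsPresentedBy E x') (hx' : symb 0 x' = 0) : ∃ u v, x * u = v * x' ∧ symb 0 u ≠ 0 := by
  obtain ⟨φ⟩ := h
  obtain ⟨φ'⟩ := h'
  let ψ := φ.symm.trans φ'
  obtain ⟨u, hu⟩ := Submodule.Quotient.mk_surjective _ (ψ (Submodule.Quotient.mk 1))
  obtain ⟨w, hw⟩ := Submodule.Quotient.mk_surjective _ (ψ.symm (Submodule.Quotient.mk 1))
  have hmk : ∀ f : ABAlgebra, ψ (Submodule.Quotient.mk f) = Submodule.Quotient.mk (f * u) := by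
    intro f
    have : (Submodule.Quotient.mk f : ABAlgebra ⧸ Submodule.span ABAlgebra {x})
        = f • Submodule.Quotient.mk 1 := by
      rw [← Submodule.Quotient.mk_smul, smul_eq_mul, mul_one]
    rw [this, map_smul, ← hu, ← Submodule.Quotient.mk_smul, smul_eq_mul]
  have h1 := hmk x
  rw [(Submodule.Quotient.mk_eq_zero _).2 (Submodule.mem_span_singleton_self x), map_zero, eq_comm,
    Submodule.Quotient.mk_eq_zero, Submodule.mem_span_singleton] at h1
  obtain ⟨v, hv⟩ := h1
  refine ⟨u, v, hv.symm, fun hu0 => ?_⟩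
  have h2 := hmk w
  -- Surjectivity gives `1 - w u ∈ Ã x'`. If `u`, like `x'`, had no constant term, neither would
  -- `1`.
  rw [hw, LinearEquiv.apply_symm_apply, Submodule.Quotient.eq, Submodule.mem_span_singleton] at h2
  obtain ⟨z, hz⟩ := h2
  have h3 := congrArg (symb 0) hz
  have hmul : ∀ f g, symb 0 g = 0 → symb 0 (f * g) = 0 := fun f g hg => by
    simp [symb_mul, hg]
  rw [smul_eq_mul, symb_sub, hmul z x' hx', hmul w u hu0, symb_one, if_pos rfl, sub_zero] at h3
  exact zero_ne_one h3

/-- Right multiplication by the unit `u` carries `Ã x` onto `Ã x u`. The extra unit `v` on the left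
does not change this ideal and keeps the leading form of `x`. -/
theorem IsPresentedBy.conj {x u v : ABAlgebra} (h : IsPresentedBy E x) (huv : u * v = 1)
    (hvu : v * u = 1) : IsPresentedBy E (v * (x * u)) := by
  obtain ⟨φ⟩ := h
  let ρ : ABAlgebra ≃ₗ[ABAlgebra] ABAlgebra :=
    { toFun := fun f => f * u
      invFun := fun f => f * v
      map_add' := fun f g => add_mul f g u
      map_smul' := fun f g => mul_assoc f g u
      left_inv := fun f => (mul_assoc f u v).trans (by rw [huv, mul_one])
      right_inv := fun f => (mul_assoc f v u).trans (by rw [hvu, mul_one]) }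
  refine ⟨φ.trans (Submodule.Quotient.equiv _ _ ρ ?_)⟩
  rw [Submodule.map_span, Set.image_singleton]
  refine le_antisymm ?_ ?_
  · rw [Submodule.span_singleton_le_iff_mem, Submodule.mem_span_singleton]
    refine ⟨u, ?_⟩
    rw [smul_eq_mul, ← mul_assoc, huv, one_mul]
    rfl
  · rw [Submodule.span_singleton_le_iff_mem, Submodule.mem_span_singleton]
    exact ⟨v, rfl⟩

theorem symb_of_presentation {k d : ℕ} {n : ℤ} (hn : n = (k : ℤ) + 1 - d) {P R : ABAlgebra}
    (hP : IsMonicHomogeneous k P) (hR : HasValuationGE n R) :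
    (∀ i < k, symb i (P + b ^ d * R) = 0) ∧ symb k (P + b ^ d * R) = symb k P := by
  have h := symb_b_pow_mul_eq_zero hn hR
  have hP' := (isMonicHomogeneous_iff.1 hP).1
  refine ⟨fun i hi => ?_, ?_⟩
  · rw [symb_add, hP' i hi.ne, h i (by omega), add_zero]
  · rw [symb_add, h k (by omega), add_zero]

/-- The Bernstein element is the initial form of the generator from `exists_presentation`. -/
theorem exists_isBernsteinElement (hreg : IsRegularABModule E) (hmono : IsMonogenic E) :
    ∃ P : ABAlgebra, IsBernsteinElement E P := by
  obtain ⟨y, hy, hv, hpres⟩ := exists_presentation hreg hmono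
  set k := abRank E with hk
  have hhom : ∀ m, symb m (homPart (k : ℤ) (a ^ k + y)) = if m = k then symb m (a ^ k + y) else 0 :=
    fun m => by
      rw [symb_homPart]
      simp only [Nat.cast_inj]
  have hcf : cf 0 k (a ^ k + y) = 1 := by
    have := isPolyDegreeLT_iff_cf.1 hy 0 k le_rfl
    rw [cf] at *
    rw [coeffB_add, coeff_add, this, ← modB_apply, map_pow, modB_a]
    simp
  obtain ⟨R, hR, hRd, hRv⟩ := exists_eq_b_pow_mul_of (k := k) (d := 2) (n := (k : ℤ) - 1)
    (y := a ^ k + y - homPart (k : ℤ) (a ^ k + y)) (by push_cast; ring)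
    (by
      rw [isPolyDegreeLT_iff]
      intro n
      rw [symb_sub, hhom]
      split_ifs with h
      · rw [sub_self, degree_zero]
        exact WithBot.bot_lt_coe k
      · rw [sub_zero, symb_add, symb_a_pow, if_neg h, zero_add]
        exact isPolyDegreeLT_iff.1 hy n)
    (by
      intro i hi
      rw [symb_sub, hhom]
      split_ifs with h
      · rw [sub_self]
      · rw [sub_zero]
        exact hv i (by omega))
    (by omega)
  refine ⟨homPart (k : ℤ) (a ^ k + y), ?_, R, hRd, hRv, ?_⟩
  · rw [isMonicHomogeneous_iff]
    refine ⟨fun m hm => by rw [hhom, if_neg hm], ?_⟩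
    rw [hhom, if_pos rfl, coeff_symb le_rfl fun ν i hi hlt => by omega, Nat.sub_self, hcf]
  · rw [← hR, add_sub_cancel]
    exact hpres

theorem IsBernsteinElement.unique {P P' : ABAlgebra} (h : IsBernsteinElement E P)
    (h' : IsBernsteinElement E P') : P = P' := by
  obtain ⟨hP, R, _, hRv, hpres⟩ := h
  obtain ⟨hP', R', _, hRv', hpres'⟩ := h'
  obtain ⟨hv, hs⟩ := symb_of_presentation (d := 2) (by push_cast; ring) hP hRv
  obtain ⟨hv', hs'⟩ := symb_of_presentation (d := 2) (by push_cast; ring) hP' hRv'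
  -- In rank zero the generator need not lack a constant term, so `u` could vanish; there `P = 1`
  -- directly.
  rcases Nat.eq_zero_or_pos (abRank E) with hk | hk
  · rw [hk] at hP hP'
    rw [hP.eq_one, hP'.eq_one]
  · have m := isMonicHomogeneous_iff.1 hP
    have m' := isMonicHomogeneous_iff.1 hP'
    obtain ⟨u, v, huv, hu⟩ := hpres.exists_mul_eq_mul hpres' (hv' 0 hk)
    have key := (symb_of_mul_eq_mul hv hv' (by rw [hs, m.2]) (by rw [hs', m'.2]) hu huv).2
    rw [hs, hs'] at key
    refine ext_symb fun n => ?_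
    by_cases hn : n = abRank E
    · rw [hn, key]
    · rw [m.1 n hn, m'.1 n hn]

theorem IsBernsteinElement.exists_isReducedPresentation {P : ABAlgebra}
    (h : IsBernsteinElement E P) : ∃ S : ABAlgebra, IsReducedPresentation E P S := by
  obtain ⟨hP, R, hRd, hRv, hpres⟩ := h
  unfold IsReducedPresentation
  generalize abRank E = k at *
  rcases k with _ | j
  · rw [hRd.eq_zero, mul_zero] at hpres
    exact ⟨0, isPolyDegreeLT_zero 0, fun ν i _ => by simp, by rwa [mul_zero]⟩
  obtain ⟨hhom, hcoeff⟩ := isMonicHomogeneous_iff.1 hP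
  have hRs := symb_b_pow_mul_eq_zero (k := j + 1) (d := 2) (by push_cast; ring) hRv
  have hp : (symb (j + 1) P).degree < (j + 1 + 1 : ℕ) := degree_symb_lt _ P
  set r := (symb (j + 2) (b ^ 2 * R)).coeff j
  -- The coefficient of `X^j` in the symbol of `[P, β b]` is `β (j + 1)`; this choice cancels the
  -- coefficient `r` of the unwanted monomial `b² a^j`.
  set β : ℂ := -r / (j + 1 : ℕ)
  have hj : ((j + 1 : ℕ) : ℂ) ≠ 0 := Nat.cast_ne_zero.2 (Nat.succ_ne_zero j)
  obtain ⟨U, V, hUb, huv, hvu⟩ := exists_ofSeries_eq_one_add β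
  -- With `U = 1 + β b`, moving `U` to the left past `P` costs exactly `[P, β b]`, so `x U = U P +
  -- Y`.
  set Y := ⁅P, (0 : ℂ) • a + β • b⁆ + b ^ 2 * R * ofSeries U
  have hY : ofSeries V * ((P + b ^ 2 * R) * ofSeries U) = P + ofSeries V * Y := by
    have : (P + b ^ 2 * R) * ofSeries U = ofSeries U * P + Y := by
      simp only [Y, Ring.lie_def, hUb, zero_smul, zero_add]
      rw [add_mul P, mul_add P, add_mul 1, mul_one P, one_mul P]
      abel
    rw [this, mul_add, ← mul_assoc, hvu, one_mul]
  have hYd : IsPolyDegreeLT (j + 1) Y := by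
    refine IsPolyDegreeLT.add ?_ (hRd.b_pow_mul.mul_ofSeries U)
    rw [isPolyDegreeLT_lie_iff hhom, degree_lt_iff_coeff_zero]
    exact fun m hm => coeff_commSymb_of_le hp hcoeff 0 β hm
  have hYv : ∀ i < j + 2, symb i Y = 0 := by
    intro i hi
    rw [symb_add, symb_lie_linear hhom, if_neg (by omega), zero_add]
    exact symb_mul_of_lt (n := 0) hRs (by simp) (by omega)
  have hYs : (symb (j + 2) Y).coeff j = 0 := by
    have h0 : symb 0 (ofSeries U) = 1 := by simp [hUb, symb_one, symb_b]
    have h1 : symb (j + 2) (b ^ 2 * R * ofSeries U) = symb (j + 2) (b ^ 2 * R) := by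
      rw [← add_zero (j + 2), symb_mul_add (n := 0) hRs (by simp), h0]
      simp
    rw [symb_add, symb_lie_linear hhom, if_pos rfl, h1, coeff_add, commSymb_eq, coeff_sub,
      coeff_add, coeff_C_mul, coeff_C_mul, coeff_C_mul, coeff_comp_X_add_C_one_sub_pred hp hcoeff]
    change _ + r = 0
    simp only [β]
    field_simp
    ring
  have hvY : ∀ i < j + 2, symb i (ofSeries V * Y) = 0 := fun i hi =>
    symb_mul_of_lt (m := 0) (by simp) hYv (by omega)
  have hvYs : (symb (j + 2) (ofSeries V * Y)).degree < j := by
    have h1 := symb_mul_add (m := 0) (f := ofSeries V) (by simp) hYv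
    rw [zero_add] at h1
    rw [h1, symb_ofSeries, C_comp, degree_lt_iff_coeff_zero]
    intro m hm
    rw [coeff_C_mul]
    rcases hm.eq_or_lt with rfl | hm
    · rw [hYs, mul_zero]
    · rw [(degree_lt_iff_coeff_zero _ _).1 (isPolyDegreeLT_iff.1 hYd (j + 2)) m hm, mul_zero]
  obtain ⟨S, hS, hSd, hSv⟩ := exists_eq_b_pow_mul_of (k := j + 1) (d := 3)
    (n := ((j + 1 : ℕ) : ℤ) - 2) (by push_cast; ring) (hYd.ofSeries_mul V) hvY
    (fun ν hν i hi hνi => degree_symb_lt_iff.1 hvYs ν i (by omega) (by omega))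
  refine ⟨S, hSd, hSv, ?_⟩
  rw [← hS, ← hY]
  exact hpres.conj huv hvu

theorem ABAlgebra.IsMonicHomogeneous.exists_isPolyDegreeLT_lie {k : ℕ} {P : ABAlgebra}
    (hP : IsMonicHomogeneous k P) : ∃ β : ℂ, IsPolyDegreeLT (k - 1) ⁅P, a + β • b⁆ := by
  rcases k with _ | j
  · refine ⟨0, ?_⟩
    rw [hP.eq_one, Ring.lie_def, one_mul, mul_one, sub_self]
    exact isPolyDegreeLT_zero _
  · obtain ⟨hhom, hcoeff⟩ := isMonicHomogeneous_iff.1 hP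
    have hp : (symb (j + 1) P).degree < (j + 1 + 1 : ℕ) := degree_symb_lt _ P
    obtain ⟨l, hl⟩ := exists_coeff_commSymb_pred hp hcoeff
    have hj : ((j + 1 : ℕ) : ℂ) ≠ 0 := Nat.cast_ne_zero.2 (Nat.succ_ne_zero j)
    refine ⟨-l / (j + 1 : ℕ), ?_⟩
    have := isPolyDegreeLT_lie_iff (d := j) hhom 1 (-l / (j + 1 : ℕ))
    rw [one_smul] at this
    rw [Nat.add_sub_cancel, this, degree_commSymb_lt_iff hp hcoeff, hl]
    field_simp
    ring

/-- The factor `b³` bounds the degree in `a` of both components of degree `k + 1` by `k - 2`, so the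
commutator from `exists_commSymb_of_mul_eq_mul` satisfies the same linear equation as the given `(α,
β)`. -/
theorem IsReducedPresentation.sub_eq_smul_lie {P S S' : ABAlgebra}
    (hP : IsMonicHomogeneous (abRank E) P) (h : IsReducedPresentation E P S)
    (h' : IsReducedPresentation E P S') {α β : ℂ} (hne : (α, β) ≠ (0, 0))
    (hlie : IsPolyDegreeLT (abRank E - 1) ⁅P, α • a + β • b⁆) :
    ∃ c : ℂ, ABAlgebra.b ^ 3 * homPart ((abRank E : ℤ) - 2) S
      - ABAlgebra.b ^ 3 * homPart ((abRank E : ℤ) - 2) S' = c • ⁅P, α • a + β • b⁆ := by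
  obtain ⟨hSd, hSv, hpres⟩ := h
  obtain ⟨hSd', hSv', hpres'⟩ := h'
  generalize abRank E = k at *
  rcases k with _ | j
  · rw [hSd.eq_zero, hSd'.eq_zero]
    exact ⟨0, by simp⟩
  obtain ⟨hhom, hcoeff⟩ := isMonicHomogeneous_iff.1 hP
  obtain ⟨hv, hs⟩ := symb_of_presentation (d := 3) (by push_cast; ring) hP hSv
  obtain ⟨hv', hs'⟩ := symb_of_presentation (d := 3) (by push_cast; ring) hP hSv'
  have hp : (symb (j + 1) P).degree < (j + 1 + 1 : ℕ) := degree_symb_lt _ P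
  have hnext : ∀ T, symb (j + 1 + 1) (P + b ^ 3 * T) = symb (j + 1 + 1) (b ^ 3 * T) := fun T => by
    rw [symb_add, hhom _ (by omega), zero_add]
  have hdeg : ∀ T, (symb (j + 1 + 1) (b ^ 3 * T)).degree < j := fun T =>
    degree_symb_b_pow_three_mul_lt T
  have hdeg' : ∀ T, (symb (j + 1 + 1) (P + b ^ 3 * T)).degree < (j + 1 : ℕ) := fun T => by
    rw [hnext]
    exact (hdeg T).trans_le (by exact_mod_cast j.le_succ)
  obtain ⟨u, v, huv, hu⟩ := hpres.exists_mul_eq_mul hpres' (hv' 0 j.succ_pos)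
  obtain ⟨α', β', hcomm⟩ := exists_commSymb_of_mul_eq_mul hv hv' (by rw [hs, hcoeff])
    (by rw [hs', hcoeff]) (hdeg' S) (hdeg' S') hu huv
  rw [hnext, hnext, hs] at hcomm
  obtain ⟨l, hl⟩ := exists_coeff_commSymb_pred hp hcoeff
  have hj : ((j + 1 : ℕ) : ℂ) ≠ 0 := Nat.cast_ne_zero.2 (Nat.succ_ne_zero j)
  have e1 : α * l + β * (j + 1 : ℕ) = 0 := by
    rw [Nat.add_sub_cancel, isPolyDegreeLT_lie_iff hhom, degree_commSymb_lt_iff hp hcoeff, hl]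
      at hlie
    exact hlie
  have e2 : α' * l + β' * (j + 1 : ℕ) = 0 := by
    rw [← hl, ← hcomm, coeff_sub, (degree_lt_iff_coeff_zero _ _).1 (hdeg S) j le_rfl,
      (degree_lt_iff_coeff_zero _ _).1 (hdeg S') j le_rfl, sub_zero]
  -- A solution with `α = 0` would have `β = 0` as well, since the coefficient of `β` is the rank.
  -- Hence every solution is the multiple `α' / α` of the given one.
  have hα : α ≠ 0 := by
    rintro rfl
    rw [zero_mul, zero_add] at e1
    exact hne (by rw [(mul_eq_zero.1 e1).resolve_right hj])
  have hα' : α' = α' / α * α := by field_simp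
  have hβ' : β' = α' / α * β := by
    have e3 : β' * α = α' * β := mul_right_cancel₀ hj (by linear_combination α * e2 - α' * e1)
    field_simp
    exact e3
  rw [hα', hβ', commSymb_mul] at hcomm
  refine ⟨α' / α, ext_symb fun n => ?_⟩
  rw [symb_sub, symb_b_pow_three_mul_homPart, symb_b_pow_three_mul_homPart, symb_smul,
    symb_lie_linear hhom]
  split_ifs with hn
  · rw [hn, hcomm]
  · simp

end Modules

end

theorem mainTheorem11 {E : Type*} [AddCommGroup E] [Module ABAlgebra E]
    (hreg : IsRegularABModule E) (hmono : IsMonogenic E) :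
    (∃! P : ABAlgebra, IsBernsteinElement E P) ∧
    ∀ P : ABAlgebra, IsBernsteinElement E P →
      (∃ S : ABAlgebra, IsReducedPresentation E P S) ∧
      (∃ β : ℂ, ABAlgebra.IsPolyDegreeLT (abRank E - 1) ⁅P, ABAlgebra.a + β • ABAlgebra.b⁆) ∧
      ∀ S S' : ABAlgebra, IsReducedPresentation E P S → IsReducedPresentation E P S' →
        ∀ α β : ℂ, (α, β) ≠ (0, 0) →
          ABAlgebra.IsPolyDegreeLT (abRank E - 1) ⁅P, α • ABAlgebra.a + β • ABAlgebra.b⁆ →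
          ∃ c : ℂ, ABAlgebra.b ^ 3 * ABAlgebra.homPart ((abRank E : ℤ) - 2) S
              - ABAlgebra.b ^ 3 * ABAlgebra.homPart ((abRank E : ℤ) - 2) S'
            = c • ⁅P, α • ABAlgebra.a + β • ABAlgebra.b⁆ := by
  refine ⟨?_, fun P hP => ⟨hP.exists_isReducedPresentation,
    hP.1.exists_isPolyDegreeLT_lie, fun S S' hS hS' α β hne hlie =>
      hS.sub_eq_smul_lie hP.1 hS' hne hlie⟩⟩
  obtain ⟨P, hP⟩ := exists_isBernsteinElement hreg hmono
  exact ⟨P, hP, fun P' hP' => hP'.unique hP⟩
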